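/- We work over the ground field $\mathbb{Q}$. A \emph{commutative cochain algebra} is a differential graded associative unital $\mathbb{Q}$-algebra $A^{\ast} = \{A^{n}\}_{n \geq 0}$, with differential $d$ of degree $+1$, such that $xy = (-1)^{\deg x \deg y} yx$ for homogeneous $x, y$; morphisms are unital, preserve degrees and products, and commute with $d$. A morphism is a \emph{quasi-isomorphism} if it induces an isomorphism on cohomology. We regard $\mathbb{Q}$ as a commutative cochain algebra concentrated in degree $0$; an \emph{augmentation} of $A^{\ast}$ is a morphism $A^{\ast} \to \mathbb{Q}$, and $A^{\ast} \oplus \mathbb{Q}$ carries the componentwise structure. We write $H^{0}(A^{\ast}) = \mathbb{Q}$ if the unit map $\mathbb{Q} \to H^{0}(A^{\ast})$ is an isomorphism. Let $C^{\ast}$ be a commutative cochain algebra with $H^{0}(C^{\ast}) = \mathbb{Q}$, and let $k > 0$ be an integer. A \emph{$k$-cotruncation} of $C^{\ast}$ is a morphism $\beta \colon B^{\ast} \to C^{\ast}$ of commutative cochain algebras such that $H^{0}(B^{\ast}) = \mathbb{Q}$, $H^{r}(B^{\ast}) = 0$ for $0 < r < k$, and $H^{r}(\beta) \colon H^{r}(B^{\ast})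 \to H^{r}(C^{\ast})$ is an isomorphism for all $r \geq k$. An \emph{augmented $k$-cotruncation} of $C^{\ast}$ is a morphism of the form $(\beta, \varepsilon_{B}) \colon B^{\ast} \to C^{\ast} \oplus \mathbb{Q}$, where $\beta$ is a $k$-cotruncation of $C^{\ast}$ and $\varepsilon_{B}$ is an augmentation of $B^{\ast}$. Let $A$ be a commutative cochain algebra. A commutative cochain algebra over $A$ is one equipped with a structure morphism to $A$; a morphism $f \colon B \to B'$ is over $A$ if $B$ and $B'$ are over $A$ and $f$ is compatible with the structure morphisms. A \emph{quasi-isomorphism over $A$} from $f_{1} \colon B_{1} \to B_{1}'$ to $f_{2} \colon B_{2} \to B_{2}'$ (morphisms over $A$) is a pair of quasi-isomorphisms $\beta \colon B_{1} \to B_{2}$ and $\beta' \colon B_{1}' \to B_{2}'$ over $A$ with $\beta' \circ f_{1} = f_{2} \circ \beta$. Morphisms $f_{1}, f_{2}$ over $A$ are \emph{weakly equivalent over $A$} if there is a finite chain $f_{1} \xrightarrow{\simeq} g_{1} \xleftarrow{\simeq} \dots \xrightarrow{\simeq} g_{r} \xleftarrow{\simeq} f_{2}$ of quasi-isomorphisms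 over $A$ between morphisms over $A$. A morphism $B \to A$ is regarded as a morphism over $A$ by means of itself on $B$ and the identity on $A$. \textbf{Proposition.} Any two augmented $k$-cotruncations of $C^{\ast}$ are weakly equivalent over $C^{\ast} \oplus \mathbb{Q}$. -/

import Mathlib

universe u v w

/-- A commutative cochain algebra over `ℚ`: a nonnegatively graded associative unital `ℚ`-algebra
`A = ⨁ Aⁿ`, commutative in the graded sense, with a differential `d` of degree `+1` that is a
(graded) derivation with `d² = 0`. -/
structure CochainAlg : Type (u + 1) where
  /-- the underlying vector space `⨁ Aⁿ` -/
  carrier : Type u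
  [ring : Ring carrier]
  [algebra : Algebra ℚ carrier]
  /-- the subspace of elements of degree `n` -/
  deg : ℕ → Submodule ℚ carrier
  gradedMonoid : SetLike.GradedMonoid deg
  isInternal : DirectSum.IsInternal deg
  /-- the differential -/
  d : carrier →ₗ[ℚ] carrier
  d_mem : ∀ {n : ℕ} {x : carrier}, x ∈ deg n → d x ∈ deg (n + 1)
  d_d : ∀ x : carrier, d (d x) = 0
  leibniz : ∀ {n : ℕ} {x : carrier}, x ∈ deg n → ∀ y : carrier,
    d (x * y) = d x * y + (-1) ^ n * (x * d y)
  comm : ∀ {m n : ℕ} {x y : carrier}, x ∈ deg m → y ∈ deg n →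
    x * y = (-1) ^ (m * n) * (y * x)

namespace CochainAlg

instance : CoeSort CochainAlg.{u} (Type u) := ⟨CochainAlg.carrier⟩

instance (A : CochainAlg.{u}) : Ring A := A.ring

instance (A : CochainAlg.{u}) : Algebra ℚ A := A.algebra

theorem one_mem (A : CochainAlg.{u}) : (1 : A) ∈ A.deg 0 :=
  A.gradedMonoid.one_mem

theorem d_one (A : CochainAlg.{u}) : A.d 1 = 0 := by
  have h := A.leibniz A.one_mem 1
  simpa using h

/-! ### Cohomology -/

/-- Cocycles of degree `n`. -/
def cocycles (A : CochainAlg.{u}) (n : ℕ) : Submodule ℚ A :=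
  A.deg n ⊓ LinearMap.ker A.d

/-- Coboundaries of degree `n`, i.e. the image of `d : Aⁿ⁻¹ → Aⁿ`, which is zero for `n = 0`. -/
def coboundaries (A : CochainAlg.{u}) : ℕ → Submodule ℚ A
  | 0 => ⊥
  | n + 1 => (A.deg n).map A.d

/-- The cohomology `Hⁿ(A) = ker (d : Aⁿ → Aⁿ⁺¹) / im (d : Aⁿ⁻¹ → Aⁿ)`. -/
abbrev H (A : CochainAlg.{u}) (n : ℕ) : Type u :=
  A.cocycles n ⧸ (A.coboundaries n).comap (A.cocycles n).subtype

/-- The canonical map `ℚ → H⁰(A)`, `q ↦ [q · 1]`. -/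
def unitH (A : CochainAlg.{u}) : ℚ →ₗ[ℚ] A.H 0 :=
  (Submodule.mkQ _).comp
    (LinearMap.toSpanSingleton ℚ (A.cocycles 0) ⟨1, A.one_mem, A.d_one⟩)

/-- `H⁰(A) = ℚ`. -/
def HZeroIsRat (A : CochainAlg.{u}) : Prop :=
  Function.Bijective A.unitH

/-! ### Morphisms -/

/-- A morphism of commutative cochain algebras: a unital algebra morphism of degree zero that
commutes with the differentials. -/
structure Hom (A : CochainAlg.{u}) (B : CochainAlg.{v}) where
  toAlgHom : A →ₐ[ℚ] B
  map_deg : ∀ {n : ℕ} {x : A}, x ∈ A.deg n → toAlgHom x ∈ B.deg n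
  map_d : ∀ x : A, toAlgHom (A.d x) = B.d (toAlgHom x)

namespace Hom

/-- The identity morphism. -/
def id (A : CochainAlg.{u}) : Hom A A where
  toAlgHom := AlgHom.id ℚ A
  map_deg h := h
  map_d _ := rfl

/-- The composition `g ∘ f`. -/
def comp {A : CochainAlg.{u}} {B : CochainAlg.{v}} {C : CochainAlg.{w}}
    (g : Hom B C) (f : Hom A B) : Hom A C where
  toAlgHom := g.toAlgHom.comp f.toAlgHom
  map_deg h := g.map_deg (f.map_deg h)
  map_d x := by simp [f.map_d, g.map_d]

variable {A : CochainAlg.{u}} {B : CochainAlg.{u}}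

theorem map_cocycles (f : Hom A B) (n : ℕ) {x : A} (hx : x ∈ A.cocycles n) :
    f.toAlgHom x ∈ B.cocycles n := by
  refine ⟨f.map_deg hx.1, ?_⟩
  have h : A.d x = 0 := hx.2
  change B.d (f.toAlgHom x) = 0
  rw [← f.map_d, h, map_zero]

theorem map_coboundaries (f : Hom A B) (n : ℕ) {x : A} (hx : x ∈ A.coboundaries n) :
    f.toAlgHom x ∈ B.coboundaries n := by
  cases n with
  | zero =>
    have h : x = 0 := hx
    rw [h, map_zero]
    exact Submodule.zero_mem _
  | succ n =>
    obtain ⟨y, hy, rfl⟩ := hx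
    exact ⟨f.toAlgHom y, f.map_deg hy, (f.map_d y).symm⟩

/-- The map `Hⁿ(f) : Hⁿ(A) → Hⁿ(B)`, `[x] ↦ [f x]`. -/
def mapH (f : Hom A B) (n : ℕ) : A.H n →ₗ[ℚ] B.H n :=
  Submodule.mapQ _ _
    (f.toAlgHom.toLinearMap.restrict (fun _ hx => f.map_cocycles n hx))
    (fun _ hx => f.map_coboundaries n hx)

/-- `f` is a quasi-isomorphism. -/
def IsQuasiIso (f : Hom A B) : Prop :=
  ∀ n : ℕ, Function.Bijective (f.mapH n)

end Hom

/-! ### The ground field and direct sums -/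

/-- The ground field `ℚ` as a commutative cochain algebra concentrated in degree `0`. -/
def rat : CochainAlg.{0} where
  carrier := ℚ
  deg n := if n = 0 then ⊤ else ⊥
  gradedMonoid :=
    { one_mem := by simp
      mul_mem := by
        intro i j x y hx hy
        by_cases hi : i = 0 <;> by_cases hj : j = 0 <;> simp_all }
  isInternal := by
    rw [DirectSum.isInternal_submodule_iff_iSupIndep_and_iSup_eq_top]
    constructor
    · intro i
      by_cases hi : i = 0
      · subst hi
        have h : (⨆ j, ⨆ (_ : j ≠ 0), (if j = 0 then (⊤ : Submodule ℚ ℚ) else ⊥)) = ⊥ := by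
          simp only [iSup_eq_bot]
          intro j hj
          simp [hj]
        rw [h]
        exact disjoint_bot_right
      · simp [hi]
    · exact top_unique (le_iSup_of_le 0 (by simp))
  d := 0
  d_mem _ := Submodule.zero_mem _
  d_d _ := rfl
  leibniz _ _ := by simp
  comm := by
    intro m n x y hx hy
    by_cases hm : m = 0 <;> by_cases hn : n = 0 <;> simp_all [mul_comm]

theorem isInternal_prod (A : CochainAlg.{u}) (B : CochainAlg.{v}) :
    DirectSum.IsInternal (fun n => (A.deg n).prod (B.deg n)) := by
  have hA := (DirectSum.isInternal_submodule_iff_iSupIndep_and_iSup_eq_top _).1 A.isInternal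
  have hB := (DirectSum.isInternal_submodule_iff_iSupIndep_and_iSup_eq_top _).1 B.isInternal
  rw [DirectSum.isInternal_submodule_iff_iSupIndep_and_iSup_eq_top]
  constructor
  · intro i
    rw [Submodule.disjoint_def]
    intro x hx hx'
    have h1 : (⨆ j, ⨆ (_ : j ≠ i), (A.deg j).prod (B.deg j)) ≤
        (⨆ j, ⨆ (_ : j ≠ i), A.deg j).prod (⨆ j, ⨆ (_ : j ≠ i), B.deg j) :=
      iSup₂_le fun j hj => Submodule.prod_mono
        (le_iSup₂_of_le j hj le_rfl) (le_iSup₂_of_le j hj le_rfl)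
    have h2 := h1 hx'
    exact Prod.ext (Submodule.disjoint_def.1 (hA.1 i) _ hx.1 h2.1)
      (Submodule.disjoint_def.1 (hB.1 i) _ hx.2 h2.2)
  · have h1 : (⊤ : Submodule ℚ A) ≤
        (⨆ n, (A.deg n).prod (B.deg n)).comap (LinearMap.inl ℚ A B) := by
      rw [← hA.2]
      refine iSup_le fun n a ha => ?_
      exact Submodule.mem_iSup_of_mem n ⟨ha, Submodule.zero_mem _⟩
    have h2 : (⊤ : Submodule ℚ B) ≤
        (⨆ n, (A.deg n).prod (B.deg n)).comap (LinearMap.inr ℚ A B) := by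
      rw [← hB.2]
      refine iSup_le fun n b hb => ?_
      exact Submodule.mem_iSup_of_mem n ⟨Submodule.zero_mem _, hb⟩
    refine top_unique fun x _ => ?_
    have h3 : (x.1, (0 : B)) ∈ ⨆ n, (A.deg n).prod (B.deg n) := h1 (x := x.1) trivial
    have h4 : ((0 : A), x.2) ∈ ⨆ n, (A.deg n).prod (B.deg n) := h2 (x := x.2) trivial
    simpa using Submodule.add_mem _ h3 h4

/-- The direct sum (categorical product) `A ⊕ B` of commutative cochain algebras, with
componentwise structure. -/
def prod (A : CochainAlg.{u}) (B : CochainAlg.{v}) : CochainAlg.{max u v} where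
  carrier := A × B
  deg n := (A.deg n).prod (B.deg n)
  gradedMonoid :=
    { one_mem := ⟨A.one_mem, B.one_mem⟩
      mul_mem := fun _ _ _ _ hx hy =>
        ⟨A.gradedMonoid.mul_mem hx.1 hy.1, B.gradedMonoid.mul_mem hx.2 hy.2⟩ }
  isInternal := isInternal_prod A B
  d := A.d.prodMap B.d
  d_mem h := ⟨A.d_mem h.1, B.d_mem h.2⟩
  d_d x := Prod.ext (A.d_d x.1) (B.d_d x.2)
  leibniz h y := by
    refine Prod.ext ?_ ?_
    · simpa using A.leibniz h.1 y.1
    · simpa using B.leibniz h.2 y.2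
  comm hx hy := by
    refine Prod.ext ?_ ?_
    · simpa using A.comm hx.1 hy.1
    · simpa using B.comm hx.2 hy.2

/-- The morphism `(f, g) : A → B ⊕ C` with components `f` and `g`. -/
def Hom.pair {A : CochainAlg.{u}} {B : CochainAlg.{v}} {C : CochainAlg.{w}}
    (f : Hom A B) (g : Hom A C) : Hom A (B.prod C) where
  toAlgHom := f.toAlgHom.prod g.toAlgHom
  map_deg h := ⟨f.map_deg h, g.map_deg h⟩
  map_d x := Prod.ext (f.map_d x) (g.map_d x)

/-- An augmentation of `A` is a morphism `A → ℚ`. -/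
abbrev Augmentation (A : CochainAlg.{u}) := Hom A rat

/-- `C ⊕ ℚ`. -/
abbrev plusRat (C : CochainAlg.{u}) : CochainAlg.{u} := C.prod rat

/-! ### Cotruncations -/

/-- The morphism `β : B → C` is a (cohomological) `k`-cotruncation of `C`. -/
structure IsCotruncation (k : ℕ) {B C : CochainAlg.{u}} (β : Hom B C) : Prop where
  hZero : B.HZeroIsRat
  vanish : ∀ r : ℕ, 0 < r → r < k → Subsingleton (B.H r)
  bijective : ∀ r : ℕ, k ≤ r → Function.Bijective (β.mapH r)

/-- The morphism `γ : B → C ⊕ ℚ` is an augmented `k`-cotruncation of `C`: it is of the form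
`(β, ε)` for a `k`-cotruncation `β : B → C` of `C` and an augmentation `ε` of `B`. -/
def IsAugmentedCotruncation (k : ℕ) {B C : CochainAlg.{u}} (γ : Hom B C.plusRat) : Prop :=
  ∃ (β : Hom B C) (ε : B.Augmentation), IsCotruncation k β ∧ γ = β.pair ε

/-! ### Weak equivalence of morphisms over `A` -/

/-- A morphism `f : B → B'` over `A`: `B` and `B'` carry structure morphisms to `A`, and `f` is
compatible with them. -/
structure MorOver (A : CochainAlg.{u}) : Type (u + 1) where
  src : CochainAlg.{u}
  tgt : CochainAlg.{u}
  srcStr : Hom src A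
  tgtStr : Hom tgt A
  f : Hom src tgt
  w : tgtStr.comp f = srcStr

/-- A morphism `f : B → A`, seen as a morphism over `A` by means of the identity of `A`. -/
def MorOver.ofHom {A B : CochainAlg.{u}} (f : Hom B A) : MorOver A where
  src := B
  tgt := A
  srcStr := f
  tgtStr := Hom.id A
  f := f
  w := rfl

/-- A quasi-isomorphism over `A` from `f₁ : B₁ → B₁'` to `f₂ : B₂ → B₂'`: a pair of
quasi-isomorphisms `β : B₁ → B₂` and `β' : B₁' → B₂'` over `A` with `β' ∘ f₁ = f₂ ∘ β`. -/
structure MorOver.QuasiIso {A : CochainAlg.{u}} (f₁ f₂ : MorOver A) where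
  β : Hom f₁.src f₂.src
  β' : Hom f₁.tgt f₂.tgt
  β_over : f₂.srcStr.comp β = f₁.srcStr
  β'_over : f₂.tgtStr.comp β' = f₁.tgtStr
  β_quasiIso : β.IsQuasiIso
  β'_quasiIso : β'.IsQuasiIso
  w : β'.comp f₁.f = f₂.f.comp β

/-- `f₁` and `f₂` are weakly equivalent over `A`: they are connected by a chain
`f₁ → g₁ ← ⋯ → gᵣ ← f₂` of quasi-isomorphisms over `A`, i.e. by at least one step of the form
`f → g ← f'`. -/
def MorOver.WeaklyEquivalent {A : CochainAlg.{u}} (f₁ f₂ : MorOver A) : Prop :=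
  Relation.TransGen
    (fun f f' => ∃ g : MorOver A, Nonempty (f.QuasiIso g) ∧ Nonempty (f'.QuasiIso g)) f₁ f₂

end CochainAlg

namespace CochainAlg

/-! ### Cohomology in terms of elements -/

/-! Since `ℚ` has no cohomology in positive degrees and `k > 0`, an augmented `k`-cotruncation `(β,
ε)` of `C` is itself a `k`-cotruncation of `C ⊕ ℚ` (`IsCotruncation.pair`). It therefore suffices to
compare two `k`-cotruncations `γ₁ : B₁ → A` and `γ₂ : B₂ → A` of an arbitrary `A`.

Let `P` be their homotopy pullback, formed with the path object `A ⊗ Λ(t, dt)`. A Mayer–Vietoris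
type argument shows that the map from `P` to the path object is surjective on cohomology in degrees
`≥ k` and bijective in degrees `> k`. In degree `k` injectivity may fail, because `Hᵏ⁻¹(A)` can
contribute to `Hᵏ(P)`; moreover `P` may have unwanted cohomology below `k`. Both defects are removed
by a subalgebra `Q` of `P`: scalars in degree `0`, nothing in degrees strictly between `0` and `k`,
a complement of the bad cocycles in degree `k`, everything above (`exists_isCotruncation_comp`).
Evaluating paths at `0` and `1` makes `Q` a `k`-cotruncation of `A` through `γ₁` and through `γ₂`,
and a map between `k`-cotruncations over the same target is a quasi-isomorphism
(`IsCotruncation.isQuasiIso_of_comp`). Hence `Q → B₁` and `Q → B₂` are quasi-isomorphisms.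

The two composites `Q → A` are only homotopic. To obtain strict morphisms over `A`, `B₁` is replaced
by the mapping path object `M` of `γ₁`, which lies over `A` by the end point of the path. The zigzag
`B₁ → M ← Q → B₂` then commutes with the maps to `A`. -/

theorem H_mk_eq_zero_iff {A : CochainAlg.{u}} {n : ℕ} {x : A.cocycles n} :
    (Submodule.Quotient.mk x : A.H n) = 0 ↔ x.1 ∈ A.coboundaries n :=
  Submodule.Quotient.mk_eq_zero _

theorem H_mk_eq_mk_iff {A : CochainAlg.{u}} {n : ℕ} {x y : A.cocycles n} :
    (Submodule.Quotient.mk x : A.H n) = Submodule.Quotient.mk y ↔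
      x.1 - y.1 ∈ A.coboundaries n :=
  Submodule.Quotient.eq _

theorem subsingleton_H_iff {A : CochainAlg.{u}} {n : ℕ} :
    Subsingleton (A.H n) ↔ ∀ x ∈ A.cocycles n, x ∈ A.coboundaries n := by
  refine ⟨fun h x hx => H_mk_eq_zero_iff (x := ⟨x, hx⟩).1 (Subsingleton.elim _ _), fun h => ?_⟩
  refine subsingleton_of_forall_eq 0 fun y => ?_
  obtain ⟨x, rfl⟩ := Submodule.Quotient.mk_surjective _ y
  exact H_mk_eq_zero_iff.2 (h x.1 x.2)

theorem hZeroIsRat_iff {A : CochainAlg.{u}} :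
    A.HZeroIsRat ↔ (1 : A) ≠ 0 ∧ ∀ x ∈ A.cocycles 0, ∃ q : ℚ, q • (1 : A) = x := by
  have key : ∀ (q : ℚ) (x : A) (hx : x ∈ A.cocycles 0),
      A.unitH q = Submodule.Quotient.mk ⟨x, hx⟩ ↔ q • (1 : A) = x := by
    intro q x hx
    change Submodule.Quotient.mk (q • (⟨1, A.one_mem, A.d_one⟩ : A.cocycles 0)) = _ ↔ _
    rw [Submodule.Quotient.eq, Submodule.mem_comap, ← sub_eq_zero]
    exact Iff.rfl
  refine and_congr ⟨fun h h1 => ?_, fun h => ?_⟩ ⟨fun h x hx => ?_, fun h => ?_⟩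
  · have h2 := (key 1 0 (Submodule.zero_mem _)).2 (by rw [h1, smul_zero])
    exact one_ne_zero (h (h2.trans (map_zero A.unitH).symm))
  · rw [injective_iff_map_eq_zero]
    intro q hq
    have h2 := (key q 0 (Submodule.zero_mem _)).1 hq
    exact (smul_eq_zero.1 h2).resolve_right h
  · obtain ⟨q, hq⟩ := h (Submodule.Quotient.mk ⟨x, hx⟩)
    exact ⟨q, (key q x hx).1 hq⟩
  · intro y
    obtain ⟨⟨x, hx⟩, rfl⟩ := Submodule.Quotient.mk_surjective _ y
    obtain ⟨q, hq⟩ := h x hx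
    exact ⟨q, (key q x hx).2 hq⟩

namespace Hom

variable {A B D : CochainAlg.{u}}

theorem ext {A : CochainAlg.{u}} {B : CochainAlg.{v}} {f g : Hom A B}
    (h : ∀ x, f.toAlgHom x = g.toAlgHom x) : f = g := by
  cases f
  cases g
  congr
  exact AlgHom.ext h

theorem mapH_injective_iff (f : Hom A B) (n : ℕ) :
    Function.Injective (f.mapH n) ↔
      ∀ x ∈ A.cocycles n, f.toAlgHom x ∈ B.coboundaries n → x ∈ A.coboundaries n := by
  rw [injective_iff_map_eq_zero]
  constructor
  · intro h x hx hfx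
    exact H_mk_eq_zero_iff.1 (h (Submodule.Quotient.mk ⟨x, hx⟩) (H_mk_eq_zero_iff.2 hfx))
  · intro h y hy
    obtain ⟨⟨x, hx⟩, rfl⟩ := Submodule.Quotient.mk_surjective _ y
    exact H_mk_eq_zero_iff.2 (h x hx (H_mk_eq_zero_iff.1 hy))

theorem mapH_surjective_iff (f : Hom A B) (n : ℕ) :
    Function.Surjective (f.mapH n) ↔
      ∀ y ∈ B.cocycles n, ∃ x ∈ A.cocycles n, f.toAlgHom x - y ∈ B.coboundaries n := by
  constructor
  · intro h y hy
    obtain ⟨z, hz⟩ := h (Submodule.Quotient.mk ⟨y, hy⟩)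
    obtain ⟨⟨x, hx⟩, rfl⟩ := Submodule.Quotient.mk_surjective _ z
    exact ⟨x, hx, H_mk_eq_mk_iff.1 hz⟩
  · intro h z
    obtain ⟨⟨y, hy⟩, rfl⟩ := Submodule.Quotient.mk_surjective _ z
    obtain ⟨x, hx, hxy⟩ := h y hy
    exact ⟨Submodule.Quotient.mk ⟨x, hx⟩, H_mk_eq_mk_iff.2 hxy⟩

theorem mapH_comp (g : Hom B D) (f : Hom A B) (n : ℕ) :
    ⇑((g.comp f).mapH n) = g.mapH n ∘ f.mapH n := by
  funext z
  obtain ⟨⟨x, hx⟩, rfl⟩ := Submodule.Quotient.mk_surjective _ z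
  rfl

theorem mapH_id (n : ℕ) : ⇑((Hom.id A).mapH n) = _root_.id := by
  funext z
  obtain ⟨⟨x, hx⟩, rfl⟩ := Submodule.Quotient.mk_surjective _ z
  rfl

theorem isQuasiIso_id : (Hom.id A).IsQuasiIso := fun n => by
  rw [mapH_id]
  exact Function.bijective_id

theorem IsQuasiIso.of_comp_left {g : Hom B D} {f : Hom A B} (hg : g.IsQuasiIso)
    (hgf : (g.comp f).IsQuasiIso) : f.IsQuasiIso := fun n => by
  have h := hgf n
  rw [mapH_comp] at h
  exact (Function.Bijective.of_comp_iff' (hg n) _).1 h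

theorem IsQuasiIso.of_comp_right {g : Hom B D} {f : Hom A B} (hf : f.IsQuasiIso)
    (hgf : (g.comp f).IsQuasiIso) : g.IsQuasiIso := fun n => by
  have h := hgf n
  rw [mapH_comp] at h
  exact (Function.Bijective.of_comp_iff _ (hf n)).1 h

/-- Both unit maps are bijective, and morphisms preserve the unit. -/
theorem mapH_zero_bijective (f : Hom A B) (hA : A.HZeroIsRat) (hB : B.HZeroIsRat) :
    Function.Bijective (f.mapH 0) := by
  have h : ⇑(f.mapH 0) ∘ A.unitH = B.unitH := by
    funext q
    change Submodule.Quotient.mk _ = Submodule.Quotient.mk _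
    congr 1
    exact Subtype.ext ((map_smul f.toAlgHom q 1).trans (by rw [map_one]; rfl))
  have hB' : Function.Bijective (⇑(f.mapH 0) ∘ A.unitH) := by
    rw [h]
    exact hB
  exact (Function.Bijective.of_comp_iff _ hA).1 hB'

end Hom

/-! ### Cotruncations -/

section Cotruncation

variable {A B D : CochainAlg.{u}} {k : ℕ}

theorem IsCotruncation.comp_left {f : Hom A B} {g : Hom B D} (hf : IsCotruncation k f)
    (hg : ∀ r, k ≤ r → Function.Bijective (g.mapH r)) : IsCotruncation k (g.comp f) where
  hZero := hf.hZero
  vanish := hf.vanish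
  bijective r hr := by
    rw [Hom.mapH_comp]
    exact (hg r hr).comp (hf.bijective r hr)

/-- A morphism between `k`-cotruncations of `D` that is compatible with the morphisms to `D` is a
quasi-isomorphism. -/
theorem IsCotruncation.isQuasiIso_of_comp {f : Hom A B} {g : Hom B D} (hg : IsCotruncation k g)
    (hgf : IsCotruncation k (g.comp f)) : f.IsQuasiIso := by
  intro r
  rcases Nat.eq_zero_or_pos r with rfl | hr
  · exact f.mapH_zero_bijective hgf.hZero hg.hZero
  rcases lt_or_ge r k with hrk | hrk
  · have := hgf.vanish r hr hrk
    have := hg.vanish r hr hrk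
    exact ⟨Function.injective_of_subsingleton _, fun y => ⟨0, Subsingleton.elim _ _⟩⟩
  · have h := hgf.bijective r hrk
    rw [Hom.mapH_comp] at h
    exact (Function.Bijective.of_comp_iff' (hg.bijective r hrk) _).1 h

/-- As `k > 0`, only positive degrees have to be compared, and there the summand `ℚ` is zero. -/
theorem IsCotruncation.pair {f : Hom A B} (hk : 0 < k) (hf : IsCotruncation k f)
    (ε : A.Augmentation) : IsCotruncation (C := B.plusRat) k (f.pair ε) where
  hZero := hf.hZero
  vanish := hf.vanish
  bijective r hr := by
    obtain ⟨r, rfl⟩ : ∃ s, r = s + 1 := ⟨r - 1, by omega⟩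
    obtain ⟨hinj, hsurj⟩ := hf.bijective _ hr
    rw [Hom.mapH_injective_iff] at hinj
    rw [Hom.mapH_surjective_iff] at hsurj
    refine ⟨(Hom.mapH_injective_iff _ _).2 fun x hx hfx => ?_,
      (Hom.mapH_surjective_iff _ _).2 fun y hy => ?_⟩
    · obtain ⟨z, hz, hzx⟩ := hfx
      exact hinj x hx ⟨z.1, hz.1, congrArg Prod.fst hzx⟩
    · obtain ⟨x, hx, z, hz, hzx⟩ := hsurj y.1 ⟨hy.1.1, congrArg Prod.fst hy.2⟩
      refine ⟨x, hx, (z, 0), ⟨hz, Submodule.zero_mem _⟩, Prod.ext hzx ?_⟩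
      have h0 : ∀ q ∈ rat.deg (r + 1), q = 0 := fun q hq => hq
      change rat.d 0 = ε.toAlgHom x - y.2
      rw [h0 _ (ε.map_deg hx.1), h0 _ hy.1.2, map_zero, sub_zero]

end Cotruncation

/-! ### Homogeneous components -/

section Proj

variable (A : CochainAlg.{u})

/-- The projection of `A = ⨁ Aⁿ` to `Aⁿ`. -/
noncomputable def proj (n : ℕ) : A →ₗ[ℚ] A :=
  (A.deg n).subtype ∘ₗ DirectSum.component ℚ ℕ (fun n => A.deg n) n ∘ₗ
    (LinearEquiv.ofBijective (DirectSum.coeLinearMap A.deg) A.isInternal).symm.toLinearMap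

variable {A}

theorem proj_mem (n : ℕ) (x : A) : A.proj n x ∈ A.deg n :=
  Subtype.property _

theorem coeLinearMap_symm_apply {m : ℕ} {x : A} (hx : x ∈ A.deg m) :
    (LinearEquiv.ofBijective (DirectSum.coeLinearMap A.deg) A.isInternal).symm x =
      DirectSum.lof ℚ ℕ (fun n => A.deg n) m ⟨x, hx⟩ := by
  rw [LinearEquiv.symm_apply_eq]
  exact (DirectSum.coeLinearMap_lof (ι := ℕ) A.deg m ⟨x, hx⟩).symm

theorem proj_of_mem {n : ℕ} {x : A} (hx : x ∈ A.deg n) : A.proj n x = x := by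
  simp [proj, coeLinearMap_symm_apply hx, DirectSum.component.lof_self]

theorem proj_of_mem_of_ne {m n : ℕ} (h : m ≠ n) {x : A} (hx : x ∈ A.deg m) : A.proj n x = 0 := by
  simp [proj, coeLinearMap_symm_apply hx, DirectSum.component.of, h]

theorem iSup_deg_eq_top : ⨆ n, A.deg n = ⊤ :=
  A.isInternal.submodule_iSup_eq_top

@[elab_as_elim]
theorem homogeneous_induction {p : A → Prop} (x : A) (mem : ∀ n, ∀ x ∈ A.deg n, p x)
    (add : ∀ x y, p x → p y → p (x + y)) : p x := by
  have hx : x ∈ ⨆ n, A.deg n := by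
    rw [iSup_deg_eq_top]
    trivial
  -- Zero is homogeneous of degree `0`, so it needs no case of its own.
  exact Submodule.iSup_induction _ (motive := p) hx mem (mem 0 0 (Submodule.zero_mem _)) add

theorem exists_sum_proj (x : A) : ∃ s : Finset ℕ, ∑ n ∈ s, A.proj n x = x := by
  -- Quantifying over all larger index sets lets the sets for two summands be replaced by their
  -- union.
  have h : ∃ s : Finset ℕ, ∀ t : Finset ℕ, s ⊆ t → ∑ n ∈ t, A.proj n x = x := by
    induction x using homogeneous_induction with
    | mem n x hx =>
      refine ⟨{n}, fun t ht => ?_⟩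
      rw [Finset.sum_eq_single n (fun m _ hm => proj_of_mem_of_ne hm.symm hx)
        (fun hn => absurd (ht (Finset.mem_singleton_self n)) hn), proj_of_mem hx]
    | add x y hx hy =>
      obtain ⟨s, hs⟩ := hx
      obtain ⟨s', hs'⟩ := hy
      refine ⟨s ∪ s', fun t ht => ?_⟩
      simp only [map_add, Finset.sum_add_distrib]
      rw [hs t (Finset.union_subset_left ht), hs' t (Finset.union_subset_right ht)]
  obtain ⟨s, hs⟩ := h
  exact ⟨s, hs s le_rfl⟩

theorem Hom.map_proj {B : CochainAlg.{v}} (f : Hom A B) (n : ℕ) (x : A) :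
    f.toAlgHom (A.proj n x) = B.proj n (f.toAlgHom x) := by
  induction x using homogeneous_induction with
  | mem m x hx =>
    by_cases h : m = n
    · subst h
      rw [proj_of_mem hx, proj_of_mem (f.map_deg hx)]
    · rw [proj_of_mem_of_ne h hx, proj_of_mem_of_ne h (f.map_deg hx), map_zero]
  | add x y hx hy => simp only [map_add, hx, hy]

/-- Independence is witnessed by `p n`, which is the identity on `S n` and kills every other `S m`.
-/
theorem isInternal_of_proj {M : Type*} [AddCommGroup M] [Module ℚ M] {S : ℕ → Submodule ℚ M}
    (p : ℕ → M →ₗ[ℚ] M) (h₁ : ∀ n, ∀ x ∈ S n, p n x = x)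
    (h₂ : ∀ m n, m ≠ n → ∀ x ∈ S m, p n x = 0) (h₃ : ∀ x, x ∈ ⨆ n, S n) :
    DirectSum.IsInternal S := by
  rw [DirectSum.isInternal_submodule_iff_iSupIndep_and_iSup_eq_top]
  refine ⟨fun n => Submodule.disjoint_def.2 fun x hx hx' => ?_, Submodule.eq_top_iff'.2 h₃⟩
  have h : (⨆ j, ⨆ (_ : j ≠ n), S j) ≤ LinearMap.ker (p n) :=
    iSup₂_le fun j hj y hy => h₂ j n hj y hy
  rw [← h₁ n x hx]
  exact h hx'

end Proj

/-! ### Subalgebras -/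

section Sub

variable (A : CochainAlg.{u})

/-- A homogeneous subalgebra closed under the differential, as a commutative cochain algebra. -/
noncomputable def sub (S : Subalgebra ℚ A) (hS : ∀ n, ∀ x ∈ S, A.proj n x ∈ S)
    (hd : ∀ x ∈ S, A.d x ∈ S) : CochainAlg.{u} where
  carrier := S
  deg n := (A.deg n).comap S.val.toLinearMap
  gradedMonoid :=
    { one_mem := A.one_mem
      mul_mem := fun _ _ _ _ hx hy => A.gradedMonoid.mul_mem hx hy }
  isInternal := by
    refine isInternal_of_proj (M := S) (fun n => (A.proj n).restrict (p := S.toSubmodule)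
      (q := S.toSubmodule) (hS n)) (fun n x hx => Subtype.ext (proj_of_mem hx))
      (fun m n h x hx => Subtype.ext (proj_of_mem_of_ne h hx)) fun x => ?_
    obtain ⟨s, hs⟩ := exists_sum_proj x.1
    have hx : ∑ n ∈ s, (⟨A.proj n x.1, hS n _ x.2⟩ : S) = x := by
      refine Subtype.ext (Eq.trans ?_ hs)
      simp
    rw [← hx]
    exact Submodule.sum_mem _ fun n _ => Submodule.mem_iSup_of_mem n (proj_mem n x.1)
  d := A.d.restrict (p := S.toSubmodule) (q := S.toSubmodule) hd
  d_mem h := A.d_mem h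
  d_d x := Subtype.ext (A.d_d x.1)
  leibniz := fun {n x} h y => Subtype.ext ((A.leibniz h y.1).trans (by
    simp only [Subalgebra.coe_add, Subalgebra.coe_mul, Subalgebra.coe_pow, Subalgebra.coe_neg,
      Subalgebra.coe_one]
    rfl))
  comm := fun {m n x y} hx hy => Subtype.ext (by
    simpa using A.comm hx hy)

variable {A} {S : Subalgebra ℚ A} {hS : ∀ n, ∀ x ∈ S, A.proj n x ∈ S}
  {hd : ∀ x ∈ S, A.d x ∈ S}

/-- The inclusion of a subalgebra. -/
noncomputable def subIncl : Hom (A.sub S hS hd) A where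
  toAlgHom := S.val
  map_deg h := h
  map_d _ := rfl

/-- The corestriction of a morphism to a subalgebra that contains its image. -/
noncomputable def subLift {B : CochainAlg.{v}} (f : Hom B A) (hf : ∀ x, f.toAlgHom x ∈ S) :
    Hom B (A.sub S hS hd) where
  toAlgHom := f.toAlgHom.codRestrict S hf
  map_deg h := f.map_deg h
  map_d x := Subtype.ext (f.map_d x)

end Sub

/-! ### Projections and equalizers -/

/-- The first projection. -/
def Hom.fst (A : CochainAlg.{u}) (B : CochainAlg.{v}) : Hom (A.prod B) A where
  toAlgHom := AlgHom.fst ℚ A B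
  map_deg h := h.1
  map_d _ := rfl

/-- The second projection. -/
def Hom.snd (A : CochainAlg.{u}) (B : CochainAlg.{v}) : Hom (A.prod B) B where
  toAlgHom := AlgHom.snd ℚ A B
  map_deg h := h.2
  map_d _ := rfl

theorem Hom.proj_mem_equalizer {A : CochainAlg.{u}} {B : CochainAlg.{v}} (f g : Hom A B) (n : ℕ)
    (x : A) (hx : x ∈ AlgHom.equalizer f.toAlgHom g.toAlgHom) :
    A.proj n x ∈ AlgHom.equalizer f.toAlgHom g.toAlgHom := by
  rw [AlgHom.mem_equalizer] at hx ⊢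
  rw [f.map_proj, g.map_proj, hx]

theorem Hom.d_mem_equalizer {A : CochainAlg.{u}} {B : CochainAlg.{v}} (f g : Hom A B) (x : A)
    (hx : x ∈ AlgHom.equalizer f.toAlgHom g.toAlgHom) :
    A.d x ∈ AlgHom.equalizer f.toAlgHom g.toAlgHom := by
  rw [AlgHom.mem_equalizer] at hx ⊢
  rw [f.map_d, g.map_d, hx]

/-- The equalizer of two morphisms. -/
noncomputable def equalizer {A : CochainAlg.{u}} {B : CochainAlg.{v}} (f g : Hom A B) :
    CochainAlg.{u} :=
  A.sub (AlgHom.equalizer f.toAlgHom g.toAlgHom) (f.proj_mem_equalizer g) (f.d_mem_equalizer g)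

/-- The inclusion of the equalizer. -/
noncomputable def equalizerIncl {A : CochainAlg.{u}} {B : CochainAlg.{v}} (f g : Hom A B) :
    Hom (equalizer f g) A :=
  subIncl (hS := f.proj_mem_equalizer g) (hd := f.d_mem_equalizer g)

/-- The universal property of the equalizer. -/
noncomputable def equalizerLift {A : CochainAlg.{u}} {B : CochainAlg.{v}} {f g : Hom A B}
    {D : CochainAlg.{w}} (h : Hom D A)
    (hh : ∀ x, f.toAlgHom (h.toAlgHom x) = g.toAlgHom (h.toAlgHom x)) :
    Hom D (equalizer f g) :=
  subLift (hS := f.proj_mem_equalizer g) (hd := f.d_mem_equalizer g) h hh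

/-! ### Existence of cotruncations -/

section ExistsCotruncation

variable {P J : CochainAlg.{u}}

/-- A family of subspaces of the homogeneous parts that contains `1` and is closed under products
and the differential spans a commutative cochain algebra. -/
theorem exists_sub_of_family (S : ℕ → Submodule ℚ P) (hS : ∀ n, S n ≤ P.deg n)
    (h1 : 1 ∈ S 0) (hmul : ∀ m n, ∀ x ∈ S m, ∀ y ∈ S n, x * y ∈ S (m + n))
    (hd : ∀ n, ∀ x ∈ S n, P.d x ∈ S (n + 1)) :
    ∃ (Q : CochainAlg.{u}) (ι : Hom Q P), Function.Injective ι.toAlgHom ∧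
      (∀ n, ∀ x, x ∈ Q.deg n ↔ ι.toAlgHom x ∈ S n) ∧
      ∀ n, ∀ x ∈ S n, ∃ y ∈ Q.deg n, ι.toAlgHom y = x := by
  have hproj : ∀ n, ∀ x ∈ ⨆ n, S n, P.proj n x ∈ S n := by
    intro n x hx
    induction hx using Submodule.iSup_induction' with
    | mem m x hx =>
      by_cases h : m = n
      · subst h
        rwa [proj_of_mem (hS _ hx)]
      · rw [proj_of_mem_of_ne h (hS _ hx)]
        exact Submodule.zero_mem _
    | zero => simp
    | add x y _ _ hx hy =>
      rw [map_add]
      exact Submodule.add_mem _ hx hy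
  have hle : ∀ n, S n ≤ ⨆ n, S n := le_iSup S
  have hmul' : ∀ x y, x ∈ ⨆ n, S n → y ∈ ⨆ n, S n → x * y ∈ ⨆ n, S n := by
    intro x y hx hy
    induction hx using Submodule.iSup_induction' with
    | mem m x hx =>
      induction hy using Submodule.iSup_induction' with
      | mem n y hy => exact hle _ (hmul m n x hx y hy)
      | zero => simp
      | add y z _ _ hy hz =>
        rw [mul_add]
        exact Submodule.add_mem _ hy hz
    | zero => simp
    | add x z _ _ hx hz =>
      rw [add_mul]
      exact Submodule.add_mem _ hx hz
  have hd' : ∀ x ∈ ⨆ n, S n, P.d x ∈ ⨆ n, S n := by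
    intro x hx
    induction hx using Submodule.iSup_induction' with
    | mem m x hx => exact hle _ (hd m x hx)
    | zero => simp
    | add x z _ _ hx hz =>
      rw [map_add]
      exact Submodule.add_mem _ hx hz
  let T : Subalgebra ℚ P := (⨆ n, S n).toSubalgebra (hle 0 h1) hmul'
  refine ⟨P.sub T (fun n x hx => hle n (hproj n x hx)) hd', subIncl, Subtype.val_injective,
    fun n x => ⟨fun hx => ?_, fun hx => hS n hx⟩, fun n x hx => ⟨⟨x, hle n hx⟩, hS n hx, rfl⟩⟩
  have h := hproj n x.1 x.2
  rwa [proj_of_mem (show x.1 ∈ P.deg n from hx)] at h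

/-- A complement inside the ambient homogeneous part. -/
theorem exists_complement_le {M : Type*} [AddCommGroup M] [Module ℚ M] {K N : Submodule ℚ M}
    (h : K ≤ N) : ∃ V ≤ N, (∀ x ∈ K, x ∈ V → x = 0) ∧ ∀ x ∈ N, ∃ y ∈ K, ∃ v ∈ V, y + v = x := by
  obtain ⟨V, hV⟩ := exists_isCompl K
  refine ⟨V ⊓ N, inf_le_right, fun x hx hx' => Submodule.disjoint_def.1 hV.disjoint x hx hx'.1,
    fun x hx => ?_⟩
  obtain ⟨y, hy, v, hv, rfl⟩ := Submodule.mem_sup.1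
    (show x ∈ K ⊔ V by rw [hV.sup_eq_top]; trivial)
  exact ⟨y, hy, v, ⟨hv, (Submodule.add_mem_iff_right N (h hy)).1 hx⟩, rfl⟩

/-- Deleting low degrees from `P` removes the low cohomology, and shrinking degree `k` to a
complement removes the kernel of `Hᵏ(φ)`. Products of positive-degree elements that involve degree
`k` or more land above `k`, where nothing was removed, so the result is a subalgebra. -/
theorem exists_isCotruncation_comp {k : ℕ} (hk : 0 < k) (hP : (1 : P) ≠ 0) (φ : Hom P J)
    (hsurj : Function.Surjective (φ.mapH k))
    (hbij : ∀ r, k < r → Function.Bijective (φ.mapH r)) :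
    ∃ (Q : CochainAlg.{u}) (ι : Hom Q P), IsCotruncation k (φ.comp ι) := by
  -- The cocycles whose classes die under `φ`; coboundaries of `P` are among them.
  let K : Submodule ℚ P := P.cocycles k ⊓ (J.coboundaries k).comap φ.toAlgHom.toLinearMap
  obtain ⟨V, hVdeg, hKV, hKV'⟩ := exists_complement_le
    (show K ≤ P.deg k from fun x hx => hx.1.1)
  let S : ℕ → Submodule ℚ P := fun n =>
    if n = 0 then ℚ ∙ (1 : P) else if n < k then ⊥ else if n = k then V else P.deg n
  have S_zero : S 0 = ℚ ∙ (1 : P) := rfl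
  have S_lt : ∀ n, 0 < n → n < k → S n = ⊥ := fun n h0 h => by simp [S, h0.ne', h]
  have S_eq : S k = V := by simp [S, hk.ne']
  have S_gt : ∀ n, k < n → S n = P.deg n := fun n h => by
    simp [S, (hk.trans h).ne', h.not_gt, h.ne']
  have hS : ∀ n, S n ≤ P.deg n := by
    intro n
    rcases Nat.eq_zero_or_pos n with rfl | h0
    · rw [S_zero, Submodule.span_singleton_le_iff_mem]
      exact P.one_mem
    rcases lt_trichotomy n k with h | rfl | h
    · simp [S_lt n h0 h]
    · rwa [S_eq]
    · rw [S_gt n h]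
  obtain ⟨Q, ι, hι, hdeg, hlift⟩ := exists_sub_of_family S hS
    (Submodule.mem_span_singleton_self 1)
    (fun m n x hx y hy => by
      rcases Nat.eq_zero_or_pos m with rfl | hm
      · obtain ⟨q, rfl⟩ := Submodule.mem_span_singleton.1 hx
        rw [smul_mul_assoc, one_mul, zero_add]
        exact Submodule.smul_mem _ _ hy
      rcases Nat.eq_zero_or_pos n with rfl | hn
      · obtain ⟨q, rfl⟩ := Submodule.mem_span_singleton.1 hy
        rw [mul_smul_comm, mul_one, add_zero]
        exact Submodule.smul_mem _ _ hx
      rcases lt_or_ge m k with h | hmk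
      · rw [S_lt m hm h, Submodule.mem_bot] at hx
        rw [hx, zero_mul]
        exact Submodule.zero_mem _
      -- Here `m ≥ k` and `n > 0`, so the product has degree above `k`.
      · rw [S_gt _ (by omega)]
        exact P.gradedMonoid.mul_mem (hS m hx) (hS n hy))
    (fun n x hx => by
      rcases Nat.eq_zero_or_pos n with rfl | hn
      · obtain ⟨q, rfl⟩ := Submodule.mem_span_singleton.1 hx
        rw [map_smul, P.d_one, smul_zero]
        exact Submodule.zero_mem _
      rcases lt_or_ge n k with h | h
      · rw [S_lt n hn h, Submodule.mem_bot] at hx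
        rw [hx, map_zero]
        exact Submodule.zero_mem _
      · rw [S_gt _ (by omega)]
        exact P.d_mem (hS n hx))
  have hd_zero : ∀ x, Q.d x = 0 ↔ P.d (ι.toAlgHom x) = 0 := fun x => by
    rw [← ι.map_d, map_eq_zero_iff _ hι]
  have hlift_cocycle : ∀ n, ∀ x ∈ S n, P.d x = 0 → ∃ y ∈ Q.cocycles n, ι.toAlgHom y = x := by
    intro n x hx hdx
    obtain ⟨y, hy, rfl⟩ := hlift n x hx
    exact ⟨y, ⟨hy, (hd_zero y).2 hdx⟩, rfl⟩
  have hcob : ∀ r, k < r → ∀ x, ι.toAlgHom x ∈ P.coboundaries r → x ∈ Q.coboundaries r := by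
    intro r hr x hx
    obtain ⟨r, rfl⟩ : ∃ s, r = s + 1 := ⟨r - 1, by omega⟩
    obtain ⟨y, hy, hyx⟩ := hx
    suffices h : ∃ z ∈ S r, P.d z = ι.toAlgHom x by
      obtain ⟨z, hz, hzx⟩ := h
      obtain ⟨q, hq, rfl⟩ := hlift r z hz
      exact ⟨q, hq, hι ((ι.map_d q).trans hzx)⟩
    rcases (Nat.lt_succ_iff.1 hr).eq_or_lt with rfl | h
    -- The removed part `K` consists of cocycles, so `V` has the same image under `d` as all of
    -- `Pᵏ`.
    · obtain ⟨c, hc, v, hv, rfl⟩ := hKV' y hy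
      refine ⟨v, by rwa [S_eq], ?_⟩
      rw [map_add, show P.d c = 0 from hc.1.2, zero_add] at hyx
      exact hyx
    · exact ⟨y, by rwa [S_gt r h], hyx⟩
  refine ⟨Q, ι, ?_, fun r h0 hr => ?_, fun r hr => ?_⟩
  · refine hZeroIsRat_iff.2 ⟨fun h => hP ?_, fun x hx => ?_⟩
    · rw [← map_one ι.toAlgHom, h, map_zero]
    · obtain ⟨q, hq⟩ := Submodule.mem_span_singleton.1 ((hdeg 0 x).1 hx.1)
      refine ⟨q, hι ?_⟩
      rw [map_smul, map_one, hq]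
  · rw [subsingleton_H_iff]
    intro x hx
    have h := (hdeg r x).1 hx.1
    rw [S_lt r h0 hr, Submodule.mem_bot, map_eq_zero_iff _ hι] at h
    rw [h]
    exact Submodule.zero_mem _
  · rw [Hom.mapH_comp]
    rcases hr.eq_or_lt with rfl | hr
    · rw [← Hom.mapH_comp]
      refine ⟨(Hom.mapH_injective_iff _ _).2 fun x hx hφx => ?_,
        (Hom.mapH_surjective_iff _ _).2 fun y hy => ?_⟩
      · have h : ι.toAlgHom x ∈ V := S_eq ▸ (hdeg k x).1 hx.1
        have h0 := hKV _ ⟨ι.map_cocycles k hx, hφx⟩ h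
        rw [map_eq_zero_iff _ hι] at h0
        rw [h0]
        exact Submodule.zero_mem _
      · obtain ⟨x, hx, hxy⟩ := (Hom.mapH_surjective_iff _ _).1 hsurj y hy
        -- Dropping the component `c` in `K` changes `φ x` only by a coboundary and leaves a cocycle
        -- in `V`.
        obtain ⟨c, hc, v, hv, rfl⟩ := hKV' x hx.1
        have hdv : P.d v = 0 := by
          have h : P.d (c + v) = 0 := hx.2
          rwa [map_add, show P.d c = 0 from hc.1.2, zero_add] at h
        obtain ⟨z, hz, rfl⟩ := hlift_cocycle k v (by rwa [S_eq]) hdv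
        refine ⟨z, hz, ?_⟩
        have h := Submodule.sub_mem _ hxy hc.2
        rw [map_add] at h
        convert h using 1
        change φ.toAlgHom (ι.toAlgHom z) - y =
          φ.toAlgHom c + φ.toAlgHom (ι.toAlgHom z) - y - φ.toAlgHom c
        abel
    · refine (hbij r hr).comp ⟨(Hom.mapH_injective_iff _ _).2 fun x _ h => hcob r hr x h,
        (Hom.mapH_surjective_iff _ _).2 fun y hy => ?_⟩
      obtain ⟨x, hx, rfl⟩ := hlift_cocycle r y (by rw [S_gt r hr]; exact hy.1) hy.2
      refine ⟨x, hx, ?_⟩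
      rw [sub_self]
      exact Submodule.zero_mem _

end ExistsCotruncation

/-! ### The sign involution -/

section Sign

variable (A : CochainAlg.{u})

/-- The linear map that is multiplication by `(-1)ⁿ` on `Aⁿ`. -/
noncomputable def signLin : A →ₗ[ℚ] A :=
  DirectSum.toModule ℚ ℕ A (fun n => (-1 : ℚ) ^ n • (A.deg n).subtype) ∘ₗ
    (LinearEquiv.ofBijective (DirectSum.coeLinearMap A.deg) A.isInternal).symm.toLinearMap

variable {A}

theorem neg_one_pow_mul_eq_smul {R : Type*} [Ring R] [Algebra ℚ R] (n : ℕ) (x : R) :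
    (-1) ^ n * x = (-1 : ℚ) ^ n • x := by
  rw [Algebra.smul_def]
  simp

theorem signLin_of_mem {n : ℕ} {x : A} (hx : x ∈ A.deg n) : A.signLin x = (-1) ^ n * x := by
  rw [neg_one_pow_mul_eq_smul]
  simp [signLin, coeLinearMap_symm_apply hx]

theorem neg_one_pow_mul_comm {R : Type*} [Ring R] (n : ℕ) (x y : R) :
    x * ((-1) ^ n * y) = (-1) ^ n * (x * y) := by
  rw [← mul_assoc, ((Commute.neg_one_right x).pow_right n).eq, mul_assoc]

variable (A) in
/-- The algebra automorphism that is multiplication by `(-1)ⁿ` on `Aⁿ`. -/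
noncomputable def sign : A →ₐ[ℚ] A :=
  AlgHom.ofLinearMap A.signLin (by simp [signLin_of_mem A.one_mem]) fun x y => by
    induction x using homogeneous_induction with
    | mem m x hx =>
      induction y using homogeneous_induction with
      | mem n y hy =>
        rw [signLin_of_mem hx, signLin_of_mem hy,
          signLin_of_mem (A.gradedMonoid.mul_mem hx hy), mul_assoc, neg_one_pow_mul_comm n x y,
          pow_add, mul_assoc]
      | add y z hy hz => simp only [mul_add, map_add, hy, hz]
    | add x z hx hz => simp only [add_mul, map_add, hx, hz]

theorem sign_of_mem {n : ℕ} {x : A} (hx : x ∈ A.deg n) : A.sign x = (-1) ^ n * x :=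
  signLin_of_mem hx

theorem sign_sign (x : A) : A.sign (A.sign x) = x := by
  induction x using homogeneous_induction with
  | mem n x hx =>
    rw [sign_of_mem hx, map_mul, sign_of_mem hx, map_pow, map_neg, map_one, ← mul_assoc,
      ← pow_add, (Even.add_self n).neg_one_pow, one_mul]
  | add x y hx hy => simp only [map_add, hx, hy]

theorem d_neg_one_pow_mul (n : ℕ) (x : A) : A.d ((-1) ^ n * x) = (-1) ^ n * A.d x := by
  rcases neg_one_pow_eq_or A n with h | h <;> simp [h]

theorem d_sign (x : A) : A.d (A.sign x) = -A.sign (A.d x) := by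
  induction x using homogeneous_induction with
  | mem n x hx =>
    rw [sign_of_mem hx, sign_of_mem (A.d_mem hx), d_neg_one_pow_mul, pow_succ]
    simp
  | add x y hx hy =>
    simp only [map_add, hx, hy]
    abel

/-- With the involution in place of the sign `(-1)ⁿ`, the Leibniz rule is bilinear and needs no
homogeneity; it can then be checked on pure tensors. -/
theorem d_mul (x y : A) : A.d (x * y) = A.d x * y + A.sign x * A.d y := by
  induction x using homogeneous_induction with
  | mem n x hx => rw [A.leibniz hx, sign_of_mem hx, mul_assoc]
  | add x z hx hz =>
    simp only [map_add, add_mul, hx, hz]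
    abel

end Sign

/-! ### Polynomials with coefficients in a commutative cochain algebra -/

section Poly

open scoped TensorProduct Polynomial

/-- The formal integral `∫₀`. -/
noncomputable def polyInt : ℚ[X] →ₗ[ℚ] ℚ[X] :=
  (Polynomial.basisMonomials ℚ).constr ℚ fun n => Polynomial.monomial (n + 1) (1 / (n + 1 : ℚ))

theorem polyInt_monomial (n : ℕ) (q : ℚ) :
    polyInt (Polynomial.monomial n q) = Polynomial.monomial (n + 1) (q / (n + 1 : ℚ)) := by
  have h : Polynomial.monomial n q = q • Polynomial.basisMonomials ℚ n := by
    simp [Polynomial.smul_monomial]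
  rw [h, map_smul, polyInt, Module.Basis.constr_basis, Polynomial.smul_monomial]
  congr 1
  simp [div_eq_mul_inv]

theorem derivative_polyInt (f : ℚ[X]) : Polynomial.derivative (polyInt f) = f := by
  induction f using Polynomial.induction_on' with
  | add f g hf hg => simp only [map_add, hf, hg]
  | monomial n q =>
    rw [polyInt_monomial, Polynomial.derivative_monomial]
    have h : (n + 1 : ℚ) ≠ 0 := by positivity
    simp [h]

theorem polyInt_derivative (f : ℚ[X]) :
    polyInt (Polynomial.derivative f) = f - Polynomial.C (Polynomial.aeval (0 : ℚ) f) := by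
  induction f using Polynomial.induction_on' with
  | add f g hf hg =>
    simp only [map_add, hf, hg]
    abel
  | monomial n q =>
    rw [Polynomial.derivative_monomial, polyInt_monomial]
    cases n with
    | zero => simp
    | succ n =>
      have h : (n + 1 : ℚ) ≠ 0 := by positivity
      simp [h]

theorem aeval_zero_polyInt (f : ℚ[X]) : Polynomial.aeval (0 : ℚ) (polyInt f) = 0 := by
  induction f using Polynomial.induction_on' with
  | add f g hf hg => simp only [map_add, hf, hg, add_zero]
  | monomial n q => simp [polyInt_monomial]

variable (A : CochainAlg.{u})

/-- Polynomials in a central variable of degree `0`. -/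
abbrev Poly : Type u := A ⊗[ℚ] ℚ[X]

namespace Poly

/-- The differential of the coefficients. -/
noncomputable def dCoeff : A.Poly →ₗ[ℚ] A.Poly := A.d.rTensor ℚ[X]

/-- The derivative with respect to the variable. -/
noncomputable def deriv : A.Poly →ₗ[ℚ] A.Poly := Polynomial.derivative.lTensor A

/-- The integral from `0` with respect to the variable. -/
noncomputable def int : A.Poly →ₗ[ℚ] A.Poly := polyInt.lTensor A

/-- The sign involution on the coefficients. -/
noncomputable def sign : A.Poly →ₐ[ℚ] A.Poly :=
  Algebra.TensorProduct.map A.sign (AlgHom.id ℚ ℚ[X])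

/-- Constant polynomials. -/
noncomputable def const : A →ₐ[ℚ] A.Poly := Algebra.TensorProduct.includeLeft

/-- The evaluation at `q`. -/
noncomputable def eval (q : ℚ) : A.Poly →ₐ[ℚ] A :=
  (Algebra.TensorProduct.rid ℚ ℚ A).toAlgHom.comp
    (Algebra.TensorProduct.map (AlgHom.id ℚ A) (Polynomial.aeval q))

/-- Polynomials with coefficients in `Aⁿ`. -/
noncomputable def deg (n : ℕ) : Submodule ℚ A.Poly :=
  LinearMap.range ((A.deg n).subtype.rTensor ℚ[X])

/-- The projection to the polynomials with coefficients in `Aⁿ`. -/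
noncomputable def proj (n : ℕ) : A.Poly →ₗ[ℚ] A.Poly := (A.proj n).rTensor ℚ[X]

variable {A}

@[simp] theorem dCoeff_tmul (a : A) (f : ℚ[X]) : dCoeff A (a ⊗ₜ f) = A.d a ⊗ₜ f := rfl

@[simp] theorem deriv_tmul (a : A) (f : ℚ[X]) :
    deriv A (a ⊗ₜ f) = a ⊗ₜ Polynomial.derivative f := rfl

@[simp] theorem int_tmul (a : A) (f : ℚ[X]) : int A (a ⊗ₜ f) = a ⊗ₜ polyInt f := rfl

@[simp] theorem sign_tmul (a : A) (f : ℚ[X]) : sign A (a ⊗ₜ f) = A.sign a ⊗ₜ f := rfl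

@[simp] theorem proj_tmul (n : ℕ) (a : A) (f : ℚ[X]) : proj A n (a ⊗ₜ f) = A.proj n a ⊗ₜ f := rfl

theorem const_apply (a : A) : const A a = a ⊗ₜ 1 := rfl

@[simp] theorem eval_tmul (q : ℚ) (a : A) (f : ℚ[X]) :
    eval A q (a ⊗ₜ f) = Polynomial.aeval q f • a := by
  simp [eval]

theorem smul_mul (q : ℚ) (x y : A.Poly) : (q • x) * y = q • (x * y) := smul_mul_assoc q x y

theorem mul_smul (q : ℚ) (x y : A.Poly) : x * (q • y) = q • (x * y) := mul_smul_comm q x y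

theorem neg_mul (x y : A.Poly) : -x * y = -(x * y) := _root_.neg_mul x y

theorem tmul_mem_deg {n : ℕ} {a : A} (ha : a ∈ A.deg n) (f : ℚ[X]) : a ⊗ₜ f ∈ deg A n :=
  ⟨⟨a, ha⟩ ⊗ₜ f, rfl⟩

@[elab_as_elim]
theorem deg_induction {n : ℕ} {p : ∀ x : A.Poly, x ∈ deg A n → Prop}
    (tmul : ∀ (a : A) (ha : a ∈ A.deg n) (f : ℚ[X]), p (a ⊗ₜ f) (tmul_mem_deg ha f))
    (add : ∀ x y hx hy, p x hx → p y hy → p (x + y) (Submodule.add_mem _ hx hy))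
    {x : A.Poly} (hx : x ∈ deg A n) : p x hx := by
  obtain ⟨z, rfl⟩ := hx
  induction z using TensorProduct.induction_on with
  | zero =>
    have h := tmul 0 (Submodule.zero_mem _) 0
    simp only [TensorProduct.zero_tmul] at h
    simpa using h
  | tmul a f => exact tmul a.1 a.2 f
  | add y z hy hz =>
    have h := add _ _ _ _ hy hz
    simpa using h

theorem mul_mem_deg {m n : ℕ} {x y : A.Poly} (hx : x ∈ deg A m) (hy : y ∈ deg A n) :
    x * y ∈ deg A (m + n) := by
  induction hx using deg_induction with
  | tmul a ha f =>
    induction hy using deg_induction with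
    | tmul b hb g =>
      rw [Algebra.TensorProduct.tmul_mul_tmul]
      exact tmul_mem_deg (A.gradedMonoid.mul_mem ha hb) (f * g)
    | add y z _ _ hy hz =>
      rw [mul_add]
      exact Submodule.add_mem _ hy hz
  | add x z _ _ hx hz =>
    rw [add_mul]
    exact Submodule.add_mem _ hx hz

theorem mul_comm_deg {m n : ℕ} {x y : A.Poly} (hx : x ∈ deg A m) (hy : y ∈ deg A n) :
    x * y = (-1 : ℚ) ^ (m * n) • (y * x) := by
  induction hx using deg_induction with
  | tmul a ha f =>
    induction hy using deg_induction with
    | tmul b hb g =>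
      rw [Algebra.TensorProduct.tmul_mul_tmul, Algebra.TensorProduct.tmul_mul_tmul,
        A.comm ha hb, mul_comm f g, neg_one_pow_mul_eq_smul, TensorProduct.smul_tmul']
    | add y z _ _ hy hz => rw [mul_add, add_mul, smul_add, hy, hz]
  | add x z _ _ hx hz => rw [mul_add, add_mul, smul_add, hx, hz]

theorem sign_of_mem {n : ℕ} {x : A.Poly} (hx : x ∈ deg A n) :
    sign A x = (-1 : ℚ) ^ n • x := by
  induction hx using deg_induction with
  | tmul a ha f =>
    rw [sign_tmul, CochainAlg.sign_of_mem ha, neg_one_pow_mul_eq_smul, TensorProduct.smul_tmul']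
  | add x y _ _ hx hy => rw [map_add, hx, hy, smul_add]

theorem sign_mem_deg {n : ℕ} {x : A.Poly} (hx : x ∈ deg A n) : sign A x ∈ deg A n := by
  rw [sign_of_mem hx]
  exact Submodule.smul_mem _ _ hx

theorem map_mem_of_tmul {M : Type*} [AddCommGroup M] [Module ℚ M] {n : ℕ} (g : A.Poly →ₗ[ℚ] M)
    (N : Submodule ℚ M) (h : ∀ a ∈ A.deg n, ∀ f : ℚ[X], g (a ⊗ₜ f) ∈ N) {x : A.Poly}
    (hx : x ∈ deg A n) : g x ∈ N := by
  induction hx using deg_induction with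
  | tmul a ha f => exact h a ha f
  | add x y _ _ hx hy =>
    rw [map_add]
    exact Submodule.add_mem _ hx hy

theorem dCoeff_mem {n : ℕ} {x : A.Poly} (hx : x ∈ deg A n) : dCoeff A x ∈ deg A (n + 1) :=
  map_mem_of_tmul _ _ (fun _ ha f => tmul_mem_deg (A.d_mem ha) f) hx

theorem deriv_mem {n : ℕ} {x : A.Poly} (hx : x ∈ deg A n) : deriv A x ∈ deg A n :=
  map_mem_of_tmul _ _ (fun _ ha _ => tmul_mem_deg ha _) hx

theorem int_mem {n : ℕ} {x : A.Poly} (hx : x ∈ deg A n) : int A x ∈ deg A n :=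
  map_mem_of_tmul _ _ (fun _ ha _ => tmul_mem_deg ha _) hx

theorem eval_mem {n : ℕ} {x : A.Poly} (q : ℚ) (hx : x ∈ deg A n) : eval A q x ∈ A.deg n :=
  map_mem_of_tmul (eval A q).toLinearMap _ (fun a ha f => by
    rw [AlgHom.toLinearMap_apply, eval_tmul]
    exact Submodule.smul_mem _ _ ha) hx

theorem proj_of_mem {n : ℕ} {x : A.Poly} (hx : x ∈ deg A n) : proj A n x = x := by
  induction hx using deg_induction with
  | tmul a ha f => rw [proj_tmul, CochainAlg.proj_of_mem ha]
  | add x y _ _ hx hy => rw [map_add, hx, hy]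

theorem proj_of_mem_of_ne {m n : ℕ} (h : m ≠ n) {x : A.Poly} (hx : x ∈ deg A m) :
    proj A n x = 0 := by
  induction hx using deg_induction with
  | tmul a ha f => rw [proj_tmul, CochainAlg.proj_of_mem_of_ne h ha, TensorProduct.zero_tmul]
  | add x y _ _ hx hy => rw [map_add, hx, hy, add_zero]

@[elab_as_elim]
theorem homogeneous_induction {p : A.Poly → Prop} (x : A.Poly)
    (mem : ∀ n, ∀ x ∈ deg A n, p x) (add : ∀ x y, p x → p y → p (x + y)) : p x := by
  induction x using TensorProduct.induction_on with
  | zero => exact mem 0 0 (Submodule.zero_mem _)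
  | tmul a f =>
    induction a using CochainAlg.homogeneous_induction with
    | mem n a ha => exact mem n _ (tmul_mem_deg ha f)
    | add a b ha hb =>
      rw [TensorProduct.add_tmul]
      exact add _ _ ha hb
  | add x y hx hy => exact add x y hx hy

theorem dCoeff_dCoeff (x : A.Poly) : dCoeff A (dCoeff A x) = 0 := by
  induction x using TensorProduct.induction_on with
  | zero => simp
  | tmul a f => simp [A.d_d]
  | add x y hx hy => simp only [map_add, hx, hy, add_zero]

theorem deriv_dCoeff (x : A.Poly) : deriv A (dCoeff A x) = dCoeff A (deriv A x) := by
  induction x using TensorProduct.induction_on with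
  | zero => simp
  | tmul a f => simp
  | add x y hx hy => simp only [map_add, hx, hy]

theorem int_dCoeff (x : A.Poly) : int A (dCoeff A x) = dCoeff A (int A x) := by
  induction x using TensorProduct.induction_on with
  | zero => simp
  | tmul a f => simp
  | add x y hx hy => simp only [map_add, hx, hy]

theorem deriv_int (x : A.Poly) : deriv A (int A x) = x := by
  induction x using TensorProduct.induction_on with
  | zero => simp
  | tmul a f => simp [derivative_polyInt]
  | add x y hx hy => simp only [map_add, hx, hy]

theorem int_deriv (x : A.Poly) : int A (deriv A x) = x - const A (eval A 0 x) := by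
  induction x using TensorProduct.induction_on with
  | zero => simp
  | tmul a f =>
    rw [deriv_tmul, int_tmul, polyInt_derivative, TensorProduct.tmul_sub, eval_tmul, const_apply,
      TensorProduct.smul_tmul, Polynomial.smul_eq_C_mul, mul_one]
  | add x y hx hy =>
    simp only [map_add, hx, hy]
    abel

theorem eval_zero_int (x : A.Poly) : eval A 0 (int A x) = 0 := by
  induction x using TensorProduct.induction_on with
  | zero => simp
  | tmul a f => rw [int_tmul, eval_tmul, aeval_zero_polyInt, zero_smul]
  | add x y hx hy => simp only [map_add, hx, hy, add_zero]

theorem eval_dCoeff (q : ℚ) (x : A.Poly) : eval A q (dCoeff A x) = A.d (eval A q x) := by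
  induction x using TensorProduct.induction_on with
  | zero => simp
  | tmul a f => simp
  | add x y hx hy => simp only [map_add, hx, hy]

theorem eval_const (q : ℚ) (a : A) : eval A q (const A a) = a := by
  simp [const_apply]

theorem dCoeff_const (a : A) : dCoeff A (const A a) = const A (A.d a) := rfl

theorem deriv_const (a : A) : deriv A (const A a) = 0 := by
  simp [const_apply]

theorem sign_sign (x : A.Poly) : sign A (sign A x) = x := by
  induction x using TensorProduct.induction_on with
  | zero => simp
  | tmul a f => simp [CochainAlg.sign_sign]
  | add x y hx hy => simp only [map_add, hx, hy]

theorem dCoeff_sign (x : A.Poly) : dCoeff A (sign A x) = -sign A (dCoeff A x) := by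
  induction x using TensorProduct.induction_on with
  | zero => simp
  | tmul a f => simp [d_sign, TensorProduct.neg_tmul]
  | add x y hx hy =>
    simp only [map_add, hx, hy]
    abel

theorem dCoeff_mul (x y : A.Poly) :
    dCoeff A (x * y) = dCoeff A x * y + sign A x * dCoeff A y := by
  induction x using TensorProduct.induction_on with
  | zero => simp
  | tmul a f =>
    induction y using TensorProduct.induction_on with
    | zero => simp
    | tmul b g => simp [d_mul, TensorProduct.add_tmul]
    | add x y hx hy =>
      simp only [map_add, mul_add, hx, hy]
      abel
  | add x y hx hy =>
    simp only [map_add, add_mul, hx, hy]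
    abel

theorem deriv_mul (x y : A.Poly) : deriv A (x * y) = deriv A x * y + x * deriv A y := by
  induction x using TensorProduct.induction_on with
  | zero => simp
  | tmul a f =>
    induction y using TensorProduct.induction_on with
    | zero => simp
    | tmul b g => simp [TensorProduct.tmul_add]
    | add x y hx hy =>
      simp only [map_add, mul_add, hx, hy]
      abel
  | add x y hx hy =>
    simp only [map_add, add_mul, hx, hy]
    abel

end Poly

end Poly

/-! ### The path object -/

section Path

open scoped TensorProduct Polynomial

variable (A : CochainAlg.{u})

/-- The algebra `A ⊗ Λ(t, dt)`; the element `(a, b)` stands for `a + dt b`, where `a` and `b` are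
polynomials in `t`. -/
@[ext]
structure PathCarrier : Type u where
  fst : A.Poly
  snd : A.Poly

namespace PathCarrier

/-- The underlying vector space. -/
def equiv : A.PathCarrier ≃ A.Poly × A.Poly where
  toFun x := (x.1, x.2)
  invFun x := ⟨x.1, x.2⟩
  left_inv _ := rfl
  right_inv _ := rfl

noncomputable instance : AddCommGroup A.PathCarrier := (equiv A).addCommGroup

noncomputable instance : Module ℚ A.PathCarrier := (equiv A).module ℚ

/-- The sign involution comes from moving `dt` to the left: `a dt b = dt (sign a) b`. -/
noncomputable instance : Mul A.PathCarrier :=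
  ⟨fun x y => ⟨x.1 * y.1, x.2 * y.1 + Poly.sign A x.1 * y.2⟩⟩

noncomputable instance : One A.PathCarrier := ⟨⟨1, 0⟩⟩

variable {A}

@[simp] theorem fst_add (x y : A.PathCarrier) : (x + y).1 = x.1 + y.1 := rfl
@[simp] theorem snd_add (x y : A.PathCarrier) : (x + y).2 = x.2 + y.2 := rfl
@[simp] theorem fst_zero : (0 : A.PathCarrier).1 = 0 := rfl
@[simp] theorem snd_zero : (0 : A.PathCarrier).2 = 0 := rfl
@[simp] theorem fst_smul (q : ℚ) (x : A.PathCarrier) : (q • x).1 = q • x.1 := rfl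
@[simp] theorem snd_smul (q : ℚ) (x : A.PathCarrier) : (q • x).2 = q • x.2 := rfl
@[simp] theorem fst_mul (x y : A.PathCarrier) : (x * y).1 = x.1 * y.1 := rfl
@[simp] theorem snd_mul (x y : A.PathCarrier) :
    (x * y).2 = x.2 * y.1 + Poly.sign A x.1 * y.2 := rfl
@[simp] theorem fst_one : (1 : A.PathCarrier).1 = 1 := rfl
@[simp] theorem snd_one : (1 : A.PathCarrier).2 = 0 := rfl

noncomputable instance : Ring A.PathCarrier where
  __ := (inferInstance : AddCommGroup A.PathCarrier)
  zero_mul x := by ext1 <;> simp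
  mul_zero x := by ext1 <;> simp
  one_mul x := by ext1 <;> simp
  mul_one x := by ext1 <;> simp
  mul_assoc x y z := by
    ext1
    · simp [mul_assoc]
    · simp only [snd_mul, fst_mul, add_mul, mul_add, map_mul, mul_assoc, add_assoc]
  left_distrib x y z := by
    ext1
    · simp [mul_add]
    · simp only [snd_mul, fst_add, snd_add, mul_add]
      abel
  right_distrib x y z := by
    ext1
    · simp [add_mul]
    · simp only [snd_mul, fst_add, snd_add, add_mul, map_add]
      abel

noncomputable instance : Algebra ℚ A.PathCarrier :=
  Algebra.ofModule (fun q x y => by ext1 <;> simp [smul_add, Poly.smul_mul])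
    (fun q x y => by ext1 <;> simp [smul_add, Poly.mul_smul])

variable (A)

/-- The part without `dt`. -/
noncomputable def fstLin : A.PathCarrier →ₗ[ℚ] A.Poly where
  toFun x := x.1
  map_add' _ _ := rfl
  map_smul' _ _ := rfl

/-- The coefficient of `dt`. -/
noncomputable def sndLin : A.PathCarrier →ₗ[ℚ] A.Poly where
  toFun x := x.2
  map_add' _ _ := rfl
  map_smul' _ _ := rfl

/-- Linear maps to `A ⊗ Λ(t, dt)`. -/
noncomputable def mkLin {M : Type*} [AddCommGroup M] [Module ℚ M] (f g : M →ₗ[ℚ] A.Poly) :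
    M →ₗ[ℚ] A.PathCarrier where
  toFun x := ⟨f x, g x⟩
  map_add' x y := by ext1 <;> simp
  map_smul' q x := by ext1 <;> simp

/-- Polynomials with coefficients in `Aⁿ⁻¹`. -/
noncomputable def shiftDeg : ℕ → Submodule ℚ A.Poly
  | 0 => ⊥
  | n + 1 => Poly.deg A n

/-- The projection to the polynomials with coefficients in `Aⁿ⁻¹`. -/
noncomputable def shiftProj : ℕ → A.Poly →ₗ[ℚ] A.Poly
  | 0 => 0
  | n + 1 => Poly.proj A n

/-- The homogeneous part of degree `n`. -/
noncomputable def deg (n : ℕ) : Submodule ℚ A.PathCarrier :=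
  (Poly.deg A n).comap (fstLin A) ⊓ (shiftDeg A n).comap (sndLin A)

/-- The differential. -/
noncomputable def d : A.PathCarrier →ₗ[ℚ] A.PathCarrier :=
  mkLin A (Poly.dCoeff A ∘ₗ fstLin A) (Poly.deriv A ∘ₗ fstLin A - Poly.dCoeff A ∘ₗ sndLin A)

variable {A}

theorem mem_deg {n : ℕ} {x : A.PathCarrier} :
    x ∈ deg A n ↔ x.1 ∈ Poly.deg A n ∧ x.2 ∈ shiftDeg A n :=
  Iff.rfl

@[simp] theorem fst_d (x : A.PathCarrier) : (d A x).1 = Poly.dCoeff A x.1 := rfl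

-- The minus sign is `d (dt b) = -dt (d b)`. The derivative term carries none: the Leibniz sign
-- cancels against moving `dt` to the left of the coefficient.
@[simp] theorem snd_d (x : A.PathCarrier) :
    (d A x).2 = Poly.deriv A x.1 - Poly.dCoeff A x.2 := rfl

theorem isInternal_deg : DirectSum.IsInternal (deg A) := by
  refine isInternal_of_proj
    (fun n => mkLin A (Poly.proj A n ∘ₗ fstLin A) (shiftProj A n ∘ₗ sndLin A)) ?_ ?_ fun x => ?_
  · rintro n x ⟨h1, h2⟩
    refine PathCarrier.ext (Poly.proj_of_mem h1) ?_
    cases n with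
    | zero => exact Eq.symm h2
    | succ n => exact Poly.proj_of_mem h2
  · rintro m n h x ⟨h1, h2⟩
    refine PathCarrier.ext (Poly.proj_of_mem_of_ne h h1) ?_
    cases n with
    | zero => rfl
    | succ n =>
      cases m with
      | zero =>
        have h2 : x.2 = 0 := h2
        change Poly.proj A n x.2 = 0
        rw [h2, map_zero]
      | succ m => exact Poly.proj_of_mem_of_ne (by omega) h2
  · have h1 : ∀ a : A.Poly, (⟨a, 0⟩ : A.PathCarrier) ∈ ⨆ n, deg A n := fun a => by
      induction a using Poly.homogeneous_induction with
      | mem n a ha => exact Submodule.mem_iSup_of_mem n (mem_deg.2 ⟨ha, Submodule.zero_mem _⟩)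
      | add a b ha hb =>
        convert Submodule.add_mem _ ha hb using 1
        ext1 <;> simp
    have h2 : ∀ b : A.Poly, (⟨0, b⟩ : A.PathCarrier) ∈ ⨆ n, deg A n := fun a => by
      induction a using Poly.homogeneous_induction with
      | mem n a ha => exact Submodule.mem_iSup_of_mem (n + 1) (mem_deg.2 ⟨Submodule.zero_mem _, ha⟩)
      | add a b ha hb =>
        convert Submodule.add_mem _ ha hb using 1
        ext1 <;> simp
    convert Submodule.add_mem _ (h1 x.1) (h2 x.2) using 1
    ext1 <;> simp

theorem mul_mem_deg {m n : ℕ} {x y : A.PathCarrier} (hx : x ∈ deg A m) (hy : y ∈ deg A n) :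
    x * y ∈ deg A (m + n) := by
  refine ⟨Poly.mul_mem_deg hx.1 hy.1, ?_⟩
  change x.2 * y.1 + Poly.sign A x.1 * y.2 ∈ shiftDeg A (m + n)
  refine Submodule.add_mem _ ?_ ?_
  · cases m with
    | zero =>
      have h : x.2 = 0 := hx.2
      rw [h, zero_mul]
      exact Submodule.zero_mem _
    | succ m =>
      rw [Nat.add_right_comm]
      exact Poly.mul_mem_deg hx.2 hy.1
  · cases n with
    | zero =>
      have h : y.2 = 0 := hy.2
      rw [h, mul_zero]
      exact Submodule.zero_mem _
    | succ n => exact Poly.mul_mem_deg (Poly.sign_mem_deg hx.1) hy.2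

theorem d_mem {n : ℕ} {x : A.PathCarrier} (hx : x ∈ deg A n) : d A x ∈ deg A (n + 1) := by
  refine ⟨Poly.dCoeff_mem hx.1, Submodule.sub_mem _ (Poly.deriv_mem hx.1) ?_⟩
  change Poly.dCoeff A x.2 ∈ Poly.deg A n
  cases n with
  | zero =>
    have h : x.2 = 0 := hx.2
    rw [h, map_zero]
    exact Submodule.zero_mem _
  | succ n => exact Poly.dCoeff_mem hx.2

theorem d_d (x : A.PathCarrier) : d A (d A x) = 0 := by
  ext1
  · simp [Poly.dCoeff_dCoeff]
  · simp [Poly.dCoeff_dCoeff, Poly.deriv_dCoeff]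

/-- The coefficient of `dt` has degree `n - 1`, and it vanishes when `n = 0`. -/
theorem sign_snd {n : ℕ} {x : A.PathCarrier} (hx : x ∈ deg A n) :
    (-1 : ℚ) ^ n • x.2 = -Poly.sign A x.2 := by
  cases n with
  | zero =>
    have h : x.2 = 0 := hx.2
    simp [h]
  | succ n =>
    rw [Poly.sign_of_mem (mem_deg.1 hx).2, pow_succ, mul_neg_one]
    exact neg_smul ((-1 : ℚ) ^ n) x.2

theorem leibniz {n : ℕ} {x : A.PathCarrier} (hx : x ∈ deg A n) (y : A.PathCarrier) :
    d A (x * y) = d A x * y + (-1) ^ n * (x * d A y) := by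
  have h := (Poly.sign_of_mem (mem_deg.1 hx).1).symm
  rw [neg_one_pow_mul_eq_smul, ← smul_mul_assoc]
  ext1
  · simp only [fst_d, fst_mul, fst_add, fst_smul, h, Poly.dCoeff_mul]
  · simp only [snd_d, fst_mul, snd_mul, fst_d, snd_add, fst_smul, snd_smul,
      h, sign_snd hx, map_add, Poly.dCoeff_mul, Poly.deriv_mul,
      Poly.sign_sign, Poly.dCoeff_sign, mul_sub, sub_mul, Poly.neg_mul]
    abel

theorem comm {m n : ℕ} {x y : A.PathCarrier} (hx : x ∈ deg A m) (hy : y ∈ deg A n) :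
    x * y = (-1) ^ (m * n) * (y * x) := by
  have h1 : x.2 * y.1 = (-1 : ℚ) ^ (m * n) • (Poly.sign A y.1 * x.2) := by
    cases m with
    | zero =>
      have h : x.2 = 0 := hx.2
      simp [h]
    | succ m =>
      rw [Poly.mul_comm_deg (mem_deg.1 hx).2 (mem_deg.1 hy).1,
        Poly.sign_of_mem (mem_deg.1 hy).1, Poly.smul_mul, smul_smul, ← pow_add]
      congr 1
      rw [Nat.succ_mul, add_assoc, pow_add, (Even.add_self n).neg_one_pow, mul_one]
  have h2 : Poly.sign A x.1 * y.2 = (-1 : ℚ) ^ (m * n) • (y.2 * x.1) := by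
    cases n with
    | zero =>
      have h : y.2 = 0 := hy.2
      simp [h]
    | succ n =>
      rw [Poly.sign_of_mem (mem_deg.1 hx).1, Poly.smul_mul,
        Poly.mul_comm_deg (mem_deg.1 hx).1 (mem_deg.1 hy).2, smul_smul, ← pow_add]
      congr 2
      ring
  rw [neg_one_pow_mul_eq_smul]
  ext1
  · exact Poly.mul_comm_deg hx.1 hy.1
  · simp only [snd_mul, snd_smul, smul_add, h1, h2]
    abel

end PathCarrier

/-- The path object `A ⊗ Λ(t, dt)` of `A`. -/
noncomputable def path : CochainAlg.{u} where
  carrier := A.PathCarrier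
  deg := PathCarrier.deg A
  gradedMonoid :=
    { one_mem := PathCarrier.mem_deg.2 ⟨Poly.tmul_mem_deg A.one_mem 1, Submodule.zero_mem _⟩
      mul_mem := fun _ _ _ _ hx hy => PathCarrier.mul_mem_deg hx hy }
  isInternal := PathCarrier.isInternal_deg
  d := PathCarrier.d A
  d_mem := PathCarrier.d_mem
  d_d := PathCarrier.d_d
  leibniz := PathCarrier.leibniz
  comm := PathCarrier.comm

/-- Constant paths. -/
noncomputable def pathConst : Hom A A.path where
  toAlgHom := AlgHom.ofLinearMap (PathCarrier.mkLin A (Poly.const A).toLinearMap 0)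
    (PathCarrier.ext (map_one (Poly.const A)) rfl)
    (fun a b => PathCarrier.ext (map_mul (Poly.const A) a b) (by
      change (0 : A.Poly) = 0 * _ + _ * 0
      rw [zero_mul, mul_zero, add_zero]))
  map_deg h := ⟨Poly.tmul_mem_deg h 1, Submodule.zero_mem _⟩
  map_d a := PathCarrier.ext (Poly.dCoeff_const a).symm (by
    change 0 = Poly.deriv A (Poly.const A a) - Poly.dCoeff A 0
    rw [Poly.deriv_const, map_zero, sub_zero])

/-- The evaluation of a path at `t = q`. -/
noncomputable def pathEval (q : ℚ) : Hom A.path A where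
  toAlgHom := AlgHom.ofLinearMap ((Poly.eval A q).toLinearMap ∘ₗ PathCarrier.fstLin A)
    (map_one (Poly.eval A q)) (fun x y => map_mul (Poly.eval A q) x.1 y.1)
  map_deg h := Poly.eval_mem q h.1
  map_d x := Poly.eval_dCoeff q x.1

/-- The contraction of paths to their starting points, `a + dt b ↦ ∫₀ b`. -/
noncomputable def pathInt : A.path →ₗ[ℚ] A.path :=
  PathCarrier.mkLin A (Poly.int A ∘ₗ PathCarrier.sndLin A) 0

/-- The linear path from `a` to `b`. -/
noncomputable def segment (a b : A) : A.path :=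
  (⟨a ⊗ₜ (1 - Polynomial.X) + b ⊗ₜ Polynomial.X, 0⟩ : A.PathCarrier)

variable {A}

theorem pathEval_pathConst (q : ℚ) (a : A) :
    (A.pathEval q).toAlgHom (A.pathConst.toAlgHom a) = a :=
  Poly.eval_const q a

theorem pathEval_comp_pathConst (q : ℚ) : (A.pathEval q).comp A.pathConst = Hom.id A :=
  Hom.ext (pathEval_pathConst q)

theorem pathInt_mem {n : ℕ} {x : A.path} (hx : x ∈ A.path.deg (n + 1)) :
    A.pathInt x ∈ A.path.deg n :=
  ⟨Poly.int_mem hx.2, Submodule.zero_mem _⟩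

theorem pathInt_eq_zero {x : A.path} (hx : x ∈ A.path.deg 0) : A.pathInt x = 0 := by
  have h : PathCarrier.snd x = 0 := hx.2
  refine PathCarrier.ext ?_ rfl
  change Poly.int A (PathCarrier.snd x) = 0
  rw [h, map_zero]

/-- The fundamental theorem of calculus, used once in each component: `∫₀ a' = a - a(0)` without
`dt`, and `(∫₀ b)' = b` at `dt`. The terms with the differential of `A` cancel. Thus constant paths
are a deformation retract. -/
theorem d_pathInt (x : A.path) :
    A.path.d (A.pathInt x) + A.pathInt (A.path.d x) =
      x - A.pathConst.toAlgHom ((A.pathEval 0).toAlgHom x) := by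
  refine PathCarrier.ext ?_ ?_
  · change Poly.dCoeff A (Poly.int A (PathCarrier.snd x)) + Poly.int A (Poly.deriv A
      (PathCarrier.fst x) - Poly.dCoeff A (PathCarrier.snd x)) =
      PathCarrier.fst x - Poly.const A (Poly.eval A 0 (PathCarrier.fst x))
    rw [map_sub, Poly.int_dCoeff, Poly.int_deriv]
    abel
  · change Poly.deriv A (Poly.int A (PathCarrier.snd x)) - Poly.dCoeff A 0 + 0 =
      PathCarrier.snd x - 0
    rw [Poly.deriv_int, map_zero, sub_zero, add_zero]

/-- The contraction produces paths starting at `0`, so paired with `0` in `B` it stays inside a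
mapping path object. -/
theorem pathEval_zero_pathInt (x : A.path) : (A.pathEval 0).toAlgHom (A.pathInt x) = 0 :=
  Poly.eval_zero_int _

theorem segment_mem {n : ℕ} {a b : A} (ha : a ∈ A.deg n) (hb : b ∈ A.deg n) :
    A.segment a b ∈ A.path.deg n :=
  ⟨Submodule.add_mem _ (Poly.tmul_mem_deg ha _) (Poly.tmul_mem_deg hb _), Submodule.zero_mem _⟩

theorem pathEval_zero_segment (a b : A) : (A.pathEval 0).toAlgHom (A.segment a b) = a := by
  change Poly.eval A 0 (a ⊗ₜ (1 - Polynomial.X) + b ⊗ₜ Polynomial.X) = a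
  simp

theorem pathEval_one_segment (a b : A) : (A.pathEval 1).toAlgHom (A.segment a b) = b := by
  change Poly.eval A 1 (a ⊗ₜ (1 - Polynomial.X) + b ⊗ₜ Polynomial.X) = b
  simp

end Path

/-! ### Homotopy pullbacks -/

section PathCohomology

variable {A : CochainAlg.{u}}

/-- Evaluation at `0` is a left inverse, which gives injectivity; the homotopy `d_pathInt` gives
surjectivity. -/
theorem isQuasiIso_pathConst : A.pathConst.IsQuasiIso := by
  refine fun n => ⟨(Hom.mapH_injective_iff _ _).2 fun a _ h => ?_,
    (Hom.mapH_surjective_iff _ _).2 fun x hx => ⟨(A.pathEval 0).toAlgHom x,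
      (A.pathEval 0).map_cocycles n hx, ?_⟩⟩
  · have h1 := (A.pathEval 0).map_coboundaries n h
    rwa [pathEval_pathConst] at h1
  · have h := d_pathInt x
    rw [hx.2, map_zero, add_zero] at h
    rw [← neg_sub, ← h]
    refine Submodule.neg_mem _ ?_
    cases n with
    | zero =>
      rw [pathInt_eq_zero hx.1, map_zero]
      exact Submodule.zero_mem _
    | succ n => exact ⟨_, pathInt_mem hx.1, rfl⟩

theorem isQuasiIso_pathEval (q : ℚ) : (A.pathEval q).IsQuasiIso :=
  isQuasiIso_pathConst.of_comp_right (by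
    rw [pathEval_comp_pathConst]
    exact Hom.isQuasiIso_id)

end PathCohomology

/-! ### Replacing a morphism by its mapping path object -/

section MappingPath

variable {A B : CochainAlg.{u}} (γ : Hom B A)

/-- The pairs of an element `b` of `B` and a path in `A` that starts at `γ b`. -/
noncomputable def mappingPath : CochainAlg.{u} :=
  equalizer (γ.comp (Hom.fst B A.path)) ((A.pathEval 0).comp (Hom.snd B A.path))

/-- `b ↦ (b, γ b)`. -/
noncomputable def mappingPathConst : Hom B (mappingPath γ) :=
  equalizerLift ((Hom.id B).pair (A.pathConst.comp γ)) fun b => (pathEval_pathConst 0 (γ.toAlgHom b)).symm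

/-- The end point of the path. -/
noncomputable def mappingPathEval : Hom (mappingPath γ) A :=
  (A.pathEval 1).comp ((Hom.snd B A.path).comp (equalizerIncl _ _))

/-- The first component. -/
noncomputable def mappingPathFst : Hom (mappingPath γ) B :=
  (Hom.fst B A.path).comp (equalizerIncl _ _)

theorem mappingPathEval_comp_const : (mappingPathEval γ).comp (mappingPathConst γ) = γ :=
  Hom.ext fun b => pathEval_pathConst 1 (γ.toAlgHom b)

theorem mappingPathFst_comp_const : (mappingPathFst γ).comp (mappingPathConst γ) = Hom.id B :=
  Hom.ext fun _ => rfl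

/-- The projection to `B` is a left inverse. Conversely, a cocycle `(b, p)` differs from the image
of `b` by `(0, d (∫₀ p))`, which is a coboundary of the mapping path object. -/
theorem isQuasiIso_mappingPathConst : (mappingPathConst γ).IsQuasiIso := by
  refine fun n => ⟨(Hom.mapH_injective_iff _ _).2 fun b _ h =>
    (mappingPathFst γ).map_coboundaries n h,
    (Hom.mapH_surjective_iff _ _).2 fun x hx => ⟨(mappingPathFst γ).toAlgHom x,
      (mappingPathFst γ).map_cocycles n hx, ?_⟩⟩
  rw [← neg_sub]
  refine Submodule.neg_mem _ ?_
  obtain ⟨⟨b, p⟩, hbp⟩ := x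
  have hbp : γ.toAlgHom b = (A.pathEval 0).toAlgHom p := hbp
  obtain ⟨⟨hb, hp⟩, hd⟩ := hx
  have hd : (B.prod A.path).d (b, p) = 0 := congrArg Subtype.val hd
  have hdp : A.path.d p = 0 := congrArg Prod.snd hd
  have h := d_pathInt p
  rw [hdp, map_zero, add_zero, ← hbp] at h
  have key : ∀ y : mappingPath γ, y.1 = (0, A.path.d (A.pathInt p)) →
      y ∈ (mappingPath γ).coboundaries n := by
    intro y hy
    cases n with
    | zero =>
      refine Subtype.ext (hy.trans ?_)
      -- The only coboundary in degree `0` is zero, and a path of degree `0` has no `dt` part to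
      -- integrate.
      rw [pathInt_eq_zero (x := p) hp, map_zero]
      rfl
    | succ n =>
      refine ⟨⟨((0 : B), A.pathInt p), ?_⟩, ⟨Submodule.zero_mem _, pathInt_mem hp⟩,
        Subtype.ext (Eq.trans ?_ hy.symm)⟩
      · change γ.toAlgHom 0 = (A.pathEval 0).toAlgHom (A.pathInt p)
        rw [pathEval_zero_pathInt, map_zero]
      · exact Prod.ext (map_zero B.d) rfl
  exact key _ (Prod.ext (sub_self b) h.symm)

end MappingPath

section HomotopyPullback

variable {A B₁ B₂ : CochainAlg.{u}} (γ₁ : Hom B₁ A) (γ₂ : Hom B₂ A)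

/-- The triples of elements `b₁` of `B₁`, `b₂` of `B₂` and a path from `γ₁ b₁` to `γ₂ b₂`. -/
noncomputable def homotopyPullback : CochainAlg.{u} :=
  equalizer
    ((γ₁.comp (Hom.fst B₁ B₂)).pair (γ₂.comp (Hom.snd B₁ B₂)) |>.comp
      (Hom.fst (B₁.prod B₂) A.path))
    (((A.pathEval 0).pair (A.pathEval 1)).comp (Hom.snd (B₁.prod B₂) A.path))

namespace homotopyPullback

/-- The component in `B₁`. -/
noncomputable def fst : Hom (homotopyPullback γ₁ γ₂) B₁ :=
  (Hom.fst B₁ B₂).comp ((Hom.fst (B₁.prod B₂) A.path).comp (equalizerIncl _ _))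

/-- The component in `B₂`. -/
noncomputable def snd : Hom (homotopyPullback γ₁ γ₂) B₂ :=
  (Hom.snd B₁ B₂).comp ((Hom.fst (B₁.prod B₂) A.path).comp (equalizerIncl _ _))

/-- The path. -/
noncomputable def toPath : Hom (homotopyPullback γ₁ γ₂) A.path :=
  (Hom.snd (B₁.prod B₂) A.path).comp (equalizerIncl _ _)

theorem eval_zero_toPath :
    (A.pathEval 0).comp (toPath γ₁ γ₂) = γ₁.comp (fst γ₁ γ₂) :=
  Hom.ext fun x => (congrArg Prod.fst x.2).symm

theorem eval_one_toPath :
    (A.pathEval 1).comp (toPath γ₁ γ₂) = γ₂.comp (snd γ₁ γ₂) :=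
  Hom.ext fun x => (congrArg Prod.snd x.2).symm

/-- The morphism to the mapping path object of `γ₁`. -/
noncomputable def toMappingPath : Hom (homotopyPullback γ₁ γ₂) (mappingPath γ₁) :=
  equalizerLift ((fst γ₁ γ₂).pair (toPath γ₁ γ₂)) fun x => congrArg Prod.fst x.2

variable {γ₁ γ₂}

theorem exists_of_eval {n : ℕ} {b₁ : B₁} {b₂ : B₂} {p : A.path} (hb₁ : b₁ ∈ B₁.deg n)
    (hb₂ : b₂ ∈ B₂.deg n) (hp : p ∈ A.path.deg n)
    (h₁ : γ₁.toAlgHom b₁ = (A.pathEval 0).toAlgHom p)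
    (h₂ : γ₂.toAlgHom b₂ = (A.pathEval 1).toAlgHom p) :
    ∃ x ∈ (homotopyPullback γ₁ γ₂).deg n, (fst γ₁ γ₂).toAlgHom x = b₁ ∧
      (snd γ₁ γ₂).toAlgHom x = b₂ ∧ (toPath γ₁ γ₂).toAlgHom x = p :=
  ⟨⟨((b₁, b₂), p), Prod.ext h₁ h₂⟩, ⟨⟨hb₁, hb₂⟩, hp⟩, rfl, rfl, rfl⟩

theorem ext {x y : homotopyPullback γ₁ γ₂}
    (h₁ : (fst γ₁ γ₂).toAlgHom x = (fst γ₁ γ₂).toAlgHom y)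
    (h₂ : (snd γ₁ γ₂).toAlgHom x = (snd γ₁ γ₂).toAlgHom y)
    (h : (toPath γ₁ γ₂).toAlgHom x = (toPath γ₁ γ₂).toAlgHom y) : x = y :=
  Subtype.ext (Prod.ext (Prod.ext h₁ h₂) h)

end homotopyPullback

end HomotopyPullback

/-! ### Lifting cocycles and primitives along a morphism -/

section Lifting

variable {A B : CochainAlg.{u}}

theorem exists_cocycle_eq_add_d {γ : Hom B A} {n : ℕ}
    (h : Function.Surjective (γ.mapH (n + 1))) {a : A} (ha : a ∈ A.cocycles (n + 1)) :
    ∃ b ∈ B.cocycles (n + 1), ∃ c ∈ A.deg n, γ.toAlgHom b = a + A.d c := by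
  obtain ⟨b, hb, c, hc, hbc⟩ := (Hom.mapH_surjective_iff _ _).1 h a ha
  exact ⟨b, hb, c, hc, by rw [hbc]; abel⟩

/-- If `γ b = d a`, then `b = d c` for some `c` with `γ c` equal to `a` up to a coboundary. -/
theorem exists_d_eq {γ : Hom B A} {n : ℕ} (hs : Function.Surjective (γ.mapH (n + 1)))
    (hi : Function.Injective (γ.mapH (n + 2))) {b : B} (hb : b ∈ B.cocycles (n + 2)) {a : A}
    (ha : a ∈ A.deg (n + 1)) (hab : γ.toAlgHom b = A.d a) :
    ∃ c ∈ B.deg (n + 1), B.d c = b ∧ ∃ e ∈ A.deg n, γ.toAlgHom c = a + A.d e := by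
  obtain ⟨c, hc, rfl⟩ := (Hom.mapH_injective_iff _ _).1 hi b hb ⟨a, ha, hab.symm⟩
  -- A primitive `c` of `b` is determined up to cocycles; the error `a - γ c` is a cocycle, and a
  -- lift `z` of its class corrects `c`.
  obtain ⟨z, hz, e, he, hze⟩ := exists_cocycle_eq_add_d hs
    (show a - γ.toAlgHom c ∈ A.cocycles (n + 1) from
      ⟨Submodule.sub_mem _ ha (γ.map_deg hc), by
        change A.d (a - γ.toAlgHom c) = 0
        rw [map_sub, ← hab, γ.map_d, sub_self]⟩)
  refine ⟨c + z, Submodule.add_mem _ hc hz.1, ?_, e, he, ?_⟩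
  · rw [map_add, show B.d z = 0 from hz.2, add_zero]
  · rw [map_add, hze]
    abel

end Lifting

/-! ### Cohomology of the homotopy pullback -/

section HomotopyPullbackCohomology

variable {A B₁ B₂ : CochainAlg.{u}} {γ₁ : Hom B₁ A} {γ₂ : Hom B₂ A} {n : ℕ}

open homotopyPullback

/-- The end points of a cocycle path lift to `B₁` and `B₂` up to coboundaries `d c₁` and `d c₂`.
Adding the differential of the segment from `c₁` to `c₂` corrects both ends at once without changing
the class. -/
theorem homotopyPullback.mapH_toPath_surjective (h₁ : Function.Surjective (γ₁.mapH (n + 1)))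
    (h₂ : Function.Surjective (γ₂.mapH (n + 1))) :
    Function.Surjective ((toPath γ₁ γ₂).mapH (n + 1)) := by
  refine (Hom.mapH_surjective_iff _ _).2 fun p hp => ?_
  obtain ⟨b₁, hb₁, c₁, hc₁, e₁⟩ :=
    exists_cocycle_eq_add_d h₁ ((A.pathEval 0).map_cocycles _ hp)
  obtain ⟨b₂, hb₂, c₂, hc₂, e₂⟩ :=
    exists_cocycle_eq_add_d h₂ ((A.pathEval 1).map_cocycles _ hp)
  have hs := A.segment_mem hc₁ hc₂
  obtain ⟨x, hx, hx₁, hx₂, hxp⟩ := exists_of_eval (γ₁ := γ₁) (γ₂ := γ₂)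
    (p := p + A.path.d (A.segment c₁ c₂)) hb₁.1 hb₂.1
    (Submodule.add_mem _ hp.1 (A.path.d_mem hs))
    (by rw [map_add, Hom.map_d, pathEval_zero_segment, e₁])
    (by rw [map_add, Hom.map_d, pathEval_one_segment, e₂])
  refine ⟨x, ⟨hx, ext ?_ ?_ ?_⟩, A.segment c₁ c₂, hs, ?_⟩
  · rw [Hom.map_d, hx₁, map_zero]
    exact hb₁.2
  · rw [Hom.map_d, hx₂, map_zero]
    exact hb₂.2
  · rw [Hom.map_d, hxp, map_zero, map_add, A.path.d_d, add_zero]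
    exact hp.2
  · rw [hxp, add_sub_cancel_left]

/-- If the path component is `d p`, then `exists_d_eq` gives primitives of the other two components
that match the ends of `p` up to coboundaries, which a segment absorbs as before. Choosing these
primitives uses surjectivity one degree lower. -/
theorem homotopyPullback.mapH_toPath_injective (hs₁ : Function.Surjective (γ₁.mapH (n + 1)))
    (hi₁ : Function.Injective (γ₁.mapH (n + 2))) (hs₂ : Function.Surjective (γ₂.mapH (n + 1)))
    (hi₂ : Function.Injective (γ₂.mapH (n + 2))) :
    Function.Injective ((toPath γ₁ γ₂).mapH (n + 2)) := by
  refine (Hom.mapH_injective_iff _ _).2 fun x hx ⟨p, hp, hpx⟩ => ?_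
  have e₀ := congrArg (fun f => f.toAlgHom x) (eval_zero_toPath γ₁ γ₂)
  have e₁ := congrArg (fun f => f.toAlgHom x) (eval_one_toPath γ₁ γ₂)
  change (A.pathEval 0).toAlgHom ((toPath γ₁ γ₂).toAlgHom x) =
    γ₁.toAlgHom ((fst γ₁ γ₂).toAlgHom x) at e₀
  change (A.pathEval 1).toAlgHom ((toPath γ₁ γ₂).toAlgHom x) =
    γ₂.toAlgHom ((snd γ₁ γ₂).toAlgHom x) at e₁
  rw [← hpx, Hom.map_d] at e₀ e₁
  obtain ⟨c₁, hc₁, hd₁, a₁, ha₁, h₁⟩ := exists_d_eq hs₁ hi₁ ((fst γ₁ γ₂).map_cocycles _ hx)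
    ((A.pathEval 0).map_deg hp) e₀.symm
  obtain ⟨c₂, hc₂, hd₂, a₂, ha₂, h₂⟩ := exists_d_eq hs₂ hi₂ ((snd γ₁ γ₂).map_cocycles _ hx)
    ((A.pathEval 1).map_deg hp) e₁.symm
  have hs := A.segment_mem ha₁ ha₂
  obtain ⟨y, hy, hy₁, hy₂, hyp⟩ := exists_of_eval (γ₁ := γ₁) (γ₂ := γ₂)
    (p := p + A.path.d (A.segment a₁ a₂)) hc₁ hc₂
    (Submodule.add_mem _ hp (A.path.d_mem hs))
    (by rw [map_add, Hom.map_d, pathEval_zero_segment, h₁])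
    (by rw [map_add, Hom.map_d, pathEval_one_segment, h₂])
  refine ⟨y, hy, ext ?_ ?_ ?_⟩
  · rw [Hom.map_d, hy₁, hd₁]
  · rw [Hom.map_d, hy₂, hd₂]
  · rw [Hom.map_d, hyp, map_add, A.path.d_d, add_zero, hpx]

/-- For `k`-cotruncations `γ₁` and `γ₂` of `A` there is a morphism to their homotopy pullback whose
components are quasi-isomorphisms. -/
theorem exists_isQuasiIso_to_homotopyPullback {k : ℕ} (hk : 0 < k) (h₁ : IsCotruncation k γ₁)
    (h₂ : IsCotruncation k γ₂) :
    ∃ (Q : CochainAlg.{u}) (ι : Hom Q (homotopyPullback γ₁ γ₂)),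
      ((fst γ₁ γ₂).comp ι).IsQuasiIso ∧ ((snd γ₁ γ₂).comp ι).IsQuasiIso := by
  have hone : (1 : homotopyPullback γ₁ γ₂) ≠ 0 := fun h =>
    (hZeroIsRat_iff.1 h₁.hZero).1 (by
      rw [← map_one (fst γ₁ γ₂).toAlgHom, h, map_zero])
  have hsurj : ∀ r, k ≤ r → Function.Surjective ((toPath γ₁ γ₂).mapH r) := by
    intro r hr
    obtain ⟨r, rfl⟩ : ∃ s, r = s + 1 := ⟨r - 1, by omega⟩
    exact mapH_toPath_surjective (h₁.bijective _ hr).2 (h₂.bijective _ hr).2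
  -- For `r > k > 0` the degree `r - 1` is still at least `k`, so surjectivity is available there;
  -- for `r = k` it may not be.
  obtain ⟨Q, ι, hι⟩ := exists_isCotruncation_comp hk hone (toPath γ₁ γ₂) (hsurj k le_rfl)
    fun r hr => ⟨by
      obtain ⟨r, rfl⟩ : ∃ s, r = s + 2 := ⟨r - 2, by omega⟩
      exact mapH_toPath_injective (h₁.bijective _ (by omega)).2 (h₁.bijective _ (by omega)).1
        (h₂.bijective _ (by omega)).2 (h₂.bijective _ (by omega)).1, hsurj r hr.le⟩
  refine ⟨Q, ι, h₁.isQuasiIso_of_comp ?_, h₂.isQuasiIso_of_comp ?_⟩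
  -- Evaluation at `0` turns the cotruncation of the path object into one of `A` that factors
  -- through `γ₁`.
  · have h := hι.comp_left fun r _ => isQuasiIso_pathEval 0 r
    have e : (A.pathEval 0).comp ((toPath γ₁ γ₂).comp ι) = γ₁.comp ((fst γ₁ γ₂).comp ι) :=
      congrArg (fun f => f.comp ι) (eval_zero_toPath γ₁ γ₂)
    rwa [e] at h
  · have h := hι.comp_left fun r _ => isQuasiIso_pathEval 1 r
    have e : (A.pathEval 1).comp ((toPath γ₁ γ₂).comp ι) = γ₂.comp ((snd γ₁ γ₂).comp ι) :=
      congrArg (fun f => f.comp ι) (eval_one_toPath γ₁ γ₂)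
    rwa [e] at h

end HomotopyPullbackCohomology

/-! ### Uniqueness of cotruncations -/

namespace MorOver

variable {A B B' : CochainAlg.{u}}

/-- A quasi-isomorphism of algebras over `A`, seen as a quasi-isomorphism of morphisms over `A`. -/
def QuasiIso.ofHom {f : Hom B A} {g : Hom B' A} (β : Hom B B') (hβ : β.IsQuasiIso)
    (h : g.comp β = f) : (MorOver.ofHom f).QuasiIso (MorOver.ofHom g) where
  β := β
  β' := Hom.id A
  β_over := h
  β'_over := rfl
  β_quasiIso := hβ
  β'_quasiIso := Hom.isQuasiIso_id
  w := h.symm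

end MorOver

/-- Any two `k`-cotruncations of `A` are weakly equivalent over `A`. -/
theorem IsCotruncation.weaklyEquivalent {A B₁ B₂ : CochainAlg.{u}} {γ₁ : Hom B₁ A}
    {γ₂ : Hom B₂ A} {k : ℕ} (hk : 0 < k) (h₁ : IsCotruncation k γ₁) (h₂ : IsCotruncation k γ₂) :
    MorOver.WeaklyEquivalent (MorOver.ofHom γ₁) (MorOver.ofHom γ₂) := by
  obtain ⟨Q, ι, hι₁, hι₂⟩ := exists_isQuasiIso_to_homotopyPullback hk h₁ h₂
  have hfst : (mappingPathFst γ₁).IsQuasiIso :=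
    (isQuasiIso_mappingPathConst γ₁).of_comp_right (by
      rw [mappingPathFst_comp_const]
      exact Hom.isQuasiIso_id)
  have hι : ((homotopyPullback.toMappingPath γ₁ γ₂).comp ι).IsQuasiIso :=
    hfst.of_comp_left hι₁
  -- Following the path to its end point, `Q → M → A` equals `γ₂ ∘ snd ∘ ι`, which is the structure
  -- morphism chosen on `Q`.
  have e := congrArg (fun f => f.comp ι) (homotopyPullback.eval_one_toPath γ₁ γ₂)
  -- Two steps of the chain: `B₁ → M ← Q`, then `Q → B₂ ← B₂`, where the identity of `B₂` only
  -- completes the required shape.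
  refine (Relation.TransGen.single ⟨MorOver.ofHom (mappingPathEval γ₁),
    ⟨.ofHom _ (isQuasiIso_mappingPathConst γ₁) (mappingPathEval_comp_const γ₁)⟩,
    ⟨.ofHom _ hι (f := γ₂.comp ((homotopyPullback.snd γ₁ γ₂).comp ι)) e⟩⟩).tail
    ⟨MorOver.ofHom γ₂, ⟨.ofHom _ hι₂ rfl⟩, ⟨.ofHom _ Hom.isQuasiIso_id rfl⟩⟩

end CochainAlg

theorem mainTheorem4 (C : CochainAlg.{u}) (hC : C.HZeroIsRat) (k : ℕ) (hk : 0 < k)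
    (B₁ B₂ : CochainAlg.{u})
    (γ₁ : CochainAlg.Hom B₁ C.plusRat) (γ₂ : CochainAlg.Hom B₂ C.plusRat)
    (h₁ : CochainAlg.IsAugmentedCotruncation k γ₁)
    (h₂ : CochainAlg.IsAugmentedCotruncation k γ₂) :
    CochainAlg.MorOver.WeaklyEquivalent
      (CochainAlg.MorOver.ofHom γ₁) (CochainAlg.MorOver.ofHom γ₂) := by
  obtain ⟨β₁, ε₁, hβ₁, rfl⟩ := h₁
  obtain ⟨β₂, ε₂, hβ₂, rfl⟩ := h₂
  -- The general result applies to `A = C ⊕ ℚ` although `H⁰` of it is not `ℚ`: `IsCotruncation` puts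
  -- no condition on `H⁰` of the target.
  exact (hβ₁.pair hk ε₁).weaklyEquivalent hk (hβ₂.pair hk ε₂)
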